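/- Let $\alpha\in(0,2)$ and let $\nu$ be a Borel probability measure on $\mathbb{R}$ with bounded support which is non-degenerate, i.e. $\nu\neq\delta_b$ for every $b\in\mathbb{R}$. Put $K_\nu=(\inf\operatorname{supp}\nu,\ \sup\operatorname{supp}\nu)$. Complex powers are taken in the principal branch. Then there is a probability measure $\mu_{\nu,\alpha}$ on $\mathbb{R}$ whose Stieltjes transform is $$\int_{\mathbb{R}}\frac{1}{x-z}\,\mu_{\nu,\alpha}(dx)=-\frac{\int_{\mathbb{R}}(z-x)^{\frac{\alpha}{2}-1}\,\nu(dx)}{\int_{\mathbb{R}}(z-x)^{\frac{\alpha}{2}}\,\nu(dx)},\qquad z\in\mathbb{C}\setminus[\inf\operatorname{supp}\nu,\ \sup\operatorname{supp}\nu],$$ and $\mu_{\nu,\alpha}$ is the only probability measure on $\mathbb{R}$ for which this identity holds for all $z$ with $\operatorname{Im}z>0$. The measure $\mu_{\nu,\alpha}$ has no atoms and is absolutely continuous with respect to Lebesgue measure $\lambda$, with density $$f_{\nu,\alpha}(x)=\frac{\sin(\frac{\alpha\pi}{2})}{\pi}\cdot\frac{A_+(x)\,P_-(x)+A_-(x)\,P_+(x)}{A_+(x)^2+A_-(x)^2+2\cos(\frac{\alpha\pi}{2})\,A_+(x)A_-(x)},$$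 where $$A_\pm(x)=\int_{\mathbb{R}}(x-y)_\pm^{\frac{\alpha}{2}}\,\nu(dy),\qquad P_\pm(x)=\int_{\mathbb{R}}(x-y)_\pm^{\frac{\alpha}{2}-1}\,\nu(dy)\in[0,\infty].$$ Here, for every real exponent $p$, $t_+^{p}=t^{p}$ if $t>0$ and $t_+^{p}=0$ if $t\le 0$, and $t_-^{p}=(-t)_+^{p}$; moreover $0\cdot\infty=0$, so that $f_{\nu,\alpha}$ is defined on all of $\mathbb{R}$ with values in $[0,\infty]$. The function $f_{\nu,\alpha}$ is finite $\lambda$-almost everywhere on $\mathbb{R}$, strictly positive (possibly $+\infty$) at every point of $K_\nu$, and equal to zero at every point outside $K_\nu$. -/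

import Mathlib

open MeasureTheory
open scoped ENNReal

/-- The Stieltjes transform of a measure on the real line: Mathlib's resolvent transform at a complex
number. -/
noncomputable abbrev stieltjesTransform (μ : Measure ℝ) (z : ℂ) : ℂ :=
  resolventTransform μ z

/-- The usual formula `s_μ(z) = ∫ 1 / (x - z) μ(dx)`. -/
theorem stieltjesTransform_eq (μ : Measure ℝ) (z : ℂ) :
    stieltjesTransform μ z = ∫ x : ℝ, 1 / ((x : ℂ) - z) ∂μ := by
  simp [stieltjesTransform, resolventTransform_apply, resolvent]

/-- The function `z ↦ - ∫ (z - x)^(α/2 - 1) ν(dx) / ∫ (z - x)^(α/2) ν(dx)`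
(principal branch of the complex power). -/
noncomputable def quadFormTransform (ν : Measure ℝ) (α : ℝ) (z : ℂ) : ℂ :=
  -((∫ x : ℝ, (z - (x : ℂ)) ^ ((α : ℂ) / 2 - 1) ∂ν) /
    (∫ x : ℝ, (z - (x : ℂ)) ^ ((α : ℂ) / 2) ∂ν))

/-- The one-sided power `t_+^p`: it is `t^p` for `t > 0` and `0` for `t ≤ 0`, also when `p < 0`. -/
noncomputable def posPow (t p : ℝ) : ℝ := if 0 < t then t ^ p else 0

/-- The integral `∫ (x - y)_+^p ν(dy)`, with values in `[0, ∞]`. -/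
noncomputable def posPotential (ν : Measure ℝ) (p x : ℝ) : ℝ≥0∞ :=
  ∫⁻ y : ℝ, ENNReal.ofReal (posPow (x - y) p) ∂ν

/-- The integral `∫ (x - y)_-^p ν(dy)`, with values in `[0, ∞]`; here `t_-^p = (-t)_+^p`. -/
noncomputable def negPotential (ν : Measure ℝ) (p x : ℝ) : ℝ≥0∞ :=
  ∫⁻ y : ℝ, ENNReal.ofReal (posPow (-(x - y)) p) ∂ν

/-- The explicit density `f_{ν,α}`, with values in `[0, ∞]` and the convention `0 * ∞ = 0`.
The integrals of the powers `α/2` are finite when `ν` is finite with bounded support, so that the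
denominator, where the cosine may be negative, is formed in the real numbers. -/
noncomputable def quadFormDensity (ν : Measure ℝ) (α x : ℝ) : ℝ≥0∞ :=
  ENNReal.ofReal (Real.sin (α * Real.pi / 2) / Real.pi) *
    ((posPotential ν (α / 2) x * negPotential ν (α / 2 - 1) x +
        negPotential ν (α / 2) x * posPotential ν (α / 2 - 1) x) /
      ENNReal.ofReal
        ((posPotential ν (α / 2) x).toReal ^ 2 + (negPotential ν (α / 2) x).toReal ^ 2 +
          2 * Real.cos (α * Real.pi / 2) *
            ((posPotential ν (α / 2) x).toReal * (negPotential ν (α / 2) x).toReal)))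

/-!
Put `a = α / 2 ∈ (0, 1)`, `G z = ∫ (z - x) ^ a ν(dx)` and `N z = ∫ (z - x) ^ (a - 1) ν(dx)`, so that the
proposed transform is `S = -N / G`. The measure is recovered from `S` by boundary values.

* For `z` in the closed upper half plane the values `(z - x) ^ a` lie in a sector of opening `π a < π`,
  so there is no cancellation in `G`: `|G z| ≥ cos (π a / 2) ∫ |z - x| ^ a ν(dx)`
  (`cos_mul_absPotential_le_norm`). As `ν` is not a point mass the last integral is bounded away from `0`
  uniformly in `z` (`exists_pos_le_absPotential`). Hence `S` is holomorphic in the upper half plane,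
  `S z = O(1 / |z|)` at infinity and at positive height (`norm_quadFormTransform_le`), and
  `|S (x + i ε)|` is at most a constant times `∫ |x - y| ^ (a - 1) ν(dy)`, which is locally integrable in
  `x` by Fubini since `a - 1 > -1`.
* A holomorphic function on the closed upper half plane that is `O(1 / |w|)` is the Cauchy integral of
  its imaginary part on the real line (`eq_integral_im_div_sub`). Applied to `w ↦ S (w + i ε)`, with
  `ε → 0` by dominated convergence, it gives `S z = π⁻¹ ∫ Im S(x) / (x - z) dx`
  (`quadFormTransform_eq_integral`), where the principal branch on the negative axis is the limit from
  above.
* On the real line `G = A₊ + e^{iπa} A₋` and `N = P₊ - e^{iπa} P₋`, so that `Im S / π` is the explicit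
  density almost everywhere (`ofReal_im_quadFormTransform`). Therefore `S` is the Stieltjes transform of
  the measure `μ` with this density, and comparing `z S z → -1` with `z s_μ(z) → -μ(ℝ)` along the
  imaginary axis shows that `μ` has mass one.
* The identity extends to the lower half plane by conjugation and to real points outside the convex hull
  of the support by continuity from above (`stieltjesTransform_eq_of_notMem_Icc`).
* Uniqueness is Stieltjes inversion: `Im s_μ(x + i y) / π` is the convolution of `μ` with a Cauchy
  density of scale `y`, which converges weakly to `μ` (`tendsto_integral_mul_im_stieltjesTransform`).
-/

open Filter Topology ComplexConjugate
open ProbabilityTheory (cauchyPDFReal cauchyPDFReal_def integrable_cauchyPDFReal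
  integral_cauchyPDFReal_eq_one cauchyPDF_pos measurable_cauchyPDFReal)

/-! ### Cauchy integrals over the real line -/

/-- Cauchy's theorem on the rectangles `[-T, T] × [0, T]`: the other three sides contribute `O(1 / T)`. -/
theorem integral_eq_zero_of_differentiableOn_upperHalfPlane {Q : ℂ → ℂ} {R C : ℝ}
    (hd : DifferentiableOn ℂ Q {w | 0 ≤ w.im})
    (hb : ∀ w : ℂ, 0 ≤ w.im → R ≤ ‖w‖ → ‖Q w‖ ≤ C / ‖w‖ ^ 2)
    (hint : Integrable (fun x : ℝ => Q x)) : ∫ x : ℝ, Q x = 0 := by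
  have hlim : Tendsto (fun T : ℝ => ∫ x in (-T)..T, Q (x : ℂ)) atTop (𝓝 (∫ x : ℝ, Q x)) :=
    intervalIntegral_tendsto_integral hint tendsto_neg_atTop_atBot tendsto_id
  refine tendsto_nhds_unique hlim ?_
  have hC : Tendsto (fun T : ℝ => 4 * C / T) atTop (𝓝 0) :=
    tendsto_const_nhds.div_atTop tendsto_id
  refine squeeze_zero_norm' ?_ hC
  filter_upwards [eventually_ge_atTop (max R 1)] with T hT
  have hTR : R ≤ T := (le_max_left _ _).trans hT
  have hT0 : 0 < T := lt_of_lt_of_le one_pos ((le_max_right _ _).trans hT)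
  have hrect := Complex.integral_boundary_rect_eq_zero_of_differentiableOn Q
    (⟨-T, 0⟩ : ℂ) (⟨T, T⟩ : ℂ) (hd.mono (by
      rintro w ⟨-, hw⟩
      simp only [Set.mem_preimage, Set.uIcc_of_le hT0.le] at hw
      exact hw.1))
  have hsmall : ∀ w : ℂ, 0 ≤ w.im → T ≤ ‖w‖ → ‖Q w‖ ≤ C / T ^ 2 := by
    intro w hw hTw
    have hC0 : 0 ≤ C := by
      have h1 := (norm_nonneg _).trans (hb w hw (hTR.trans hTw))
      by_contra hneg
      have : C / ‖w‖ ^ 2 < 0 :=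
        div_neg_of_neg_of_pos (not_le.1 hneg) (pow_pos (hT0.trans_le hTw) 2)
      linarith
    exact (hb w hw (hTR.trans hTw)).trans (by gcongr)
  have htop : ‖∫ x : ℝ in (-T)..T, Q (x + (T : ℂ) * Complex.I)‖ ≤ C / T ^ 2 * |T - -T| := by
    refine intervalIntegral.norm_integral_le_of_norm_le_const fun x _ => hsmall _ ?_ ?_
    · simp [hT0.le]
    · refine le_trans ?_ (Complex.abs_im_le_norm _)
      simp [le_abs_self]
  have hright : ‖∫ y : ℝ in (0 : ℝ)..T, Q ((T : ℂ) + y * Complex.I)‖ ≤ C / T ^ 2 * |T - 0| := by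
    refine intervalIntegral.norm_integral_le_of_norm_le_const fun y hy => hsmall _ ?_ ?_
    · rw [Set.uIoc_of_le hT0.le] at hy
      simpa using hy.1.le
    · refine le_trans ?_ (Complex.abs_re_le_norm _)
      simp [le_abs_self]
  have hleft : ‖∫ y : ℝ in (0 : ℝ)..T, Q (((-T : ℝ) : ℂ) + y * Complex.I)‖
      ≤ C / T ^ 2 * |T - 0| := by
    refine intervalIntegral.norm_integral_le_of_norm_le_const fun y hy => hsmall _ ?_ ?_
    · rw [Set.uIoc_of_le hT0.le] at hy
      simpa using hy.1.le
    · refine le_trans ?_ (Complex.abs_re_le_norm _)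
      simp [le_abs_self]
  have heq : ∫ x in (-T)..T, Q (x : ℂ) =
      (∫ x : ℝ in (-T)..T, Q (x + (T : ℂ) * Complex.I)) -
      Complex.I • (∫ y : ℝ in (0 : ℝ)..T, Q ((T : ℂ) + y * Complex.I)) +
      Complex.I • (∫ y : ℝ in (0 : ℝ)..T, Q (((-T : ℝ) : ℂ) + y * Complex.I)) := by
    simp only [Complex.ofReal_zero, zero_mul, add_zero] at hrect
    linear_combination hrect
  rw [heq]
  have e1 : |T - -T| = 2 * T := by rw [abs_of_pos (by linarith)]; ring
  have e2 : |T - 0| = T := by rw [sub_zero, abs_of_pos hT0]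
  rw [e1] at htop
  rw [e2] at hright hleft
  calc _ ≤ C / T ^ 2 * (2 * T) + C / T ^ 2 * T + C / T ^ 2 * T := by
        refine (norm_add_le _ _).trans
          (add_le_add ((norm_sub_le _ _).trans (add_le_add htop ?_)) ?_)
        · rwa [norm_smul, Complex.norm_I, one_mul]
        · rwa [norm_smul, Complex.norm_I, one_mul]
    _ = 4 * C / T := by field_simp; ring

/-- A point at distance at least `δ` from `z` is also far from `z` on the scale of its own norm. -/
theorem one_add_norm_le_mul_norm_sub {z w : ℂ} {δ R : ℝ} (hδ : 0 < δ) (hz : ‖z‖ ≤ R)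
    (hzw : δ ≤ ‖w - z‖) : 1 + ‖w‖ ≤ ((1 + R) / δ + 1) * ‖w - z‖ := by
  have h1 : ‖w‖ ≤ ‖w - z‖ + ‖z‖ := by simpa using norm_add_le (w - z) z
  have h2 : 1 + R ≤ (1 + R) / δ * ‖w - z‖ := by
    rw [div_mul_eq_mul_div, le_div_iff₀ hδ]
    have := (norm_nonneg z).trans hz
    gcongr
  linarith

theorem integrable_of_norm_le_inv_sq {f : ℝ → ℂ} (hf : AEStronglyMeasurable f) {C : ℝ}
    (hb : ∀ x, ‖f x‖ ≤ C / (1 + |x|) ^ 2) : Integrable f := by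
  refine (integrable_inv_one_add_sq.const_mul C).mono' hf (Eventually.of_forall fun x => ?_)
  have hC : 0 ≤ C := by
    have := (norm_nonneg _).trans (hb 0)
    simpa using this
  refine (hb x).trans ?_
  rw [div_eq_mul_inv]
  gcongr
  nlinarith [abs_nonneg x, sq_abs x]

theorem integral_poissonKernel {z : ℂ} (hz : 0 < z.im) :
    Integrable (fun x : ℝ => (((x : ℂ) - z) * (x - conj z))⁻¹) ∧
    ∫ x : ℝ, (((x : ℂ) - z) * (x - conj z))⁻¹ = Real.pi / z.im := by
  have hk : ∀ x : ℝ, (((x : ℂ) - z) * (x - conj z))⁻¹ =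
      ((Real.pi / z.im * ProbabilityTheory.cauchyPDFReal z.re z.im.toNNReal x : ℝ) : ℂ) := by
    intro x
    have h1 : ((x : ℂ) - z) * (x - conj z) = (((x - z.re) ^ 2 + z.im ^ 2 : ℝ) : ℂ) := by
      apply Complex.ext <;> simp [pow_two] <;> ring
    have h2 : Real.pi / z.im * ProbabilityTheory.cauchyPDFReal z.re z.im.toNNReal x =
        ((x - z.re) ^ 2 + z.im ^ 2)⁻¹ := by
      rw [ProbabilityTheory.cauchyPDFReal_def]
      rw [Real.coe_toNNReal _ hz.le]
      field_simp
    rw [h1, h2, Complex.ofReal_inv]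
  have hne : z.im.toNNReal ≠ 0 := (Real.toNNReal_pos.2 hz).ne'
  simp_rw [hk]
  refine ⟨((ProbabilityTheory.integrable_cauchyPDFReal _).const_mul _).ofReal, ?_⟩
  rw [integral_complex_ofReal, integral_const_mul,
    ProbabilityTheory.integral_cauchyPDFReal_eq_one _ hne]
  simp

/-- A function holomorphic on the closed upper half plane and `O(1 / |w|)` there is the Cauchy integral of
its imaginary part on the real line. Cauchy's theorem for `F w / (w - conj z)` shows that the kernel
`1 / (x - conj z)` annihilates `F`, hence `1 / (x - z)` annihilates `conj F`; Cauchy's theorem for the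
divided difference of `F` at `z`, over `w - conj z`, yields `∫ F x / (x - z) dx = 2 π i F z`. -/
theorem eq_integral_im_div_sub {F : ℂ → ℂ} {C : ℝ}
    (hd : DifferentiableOn ℂ F {w | 0 ≤ w.im})
    (hb : ∀ w : ℂ, 0 ≤ w.im → ‖F w‖ ≤ C / (1 + ‖w‖)) {z : ℂ} (hz : 0 < z.im) :
    F z = (1 / Real.pi : ℂ) * ∫ x : ℝ, ((F x).im : ℂ) / (x - z) := by
  have hC : 0 ≤ C := by
    have := (norm_nonneg _).trans (hb 0 (by simp))
    simpa using this
  set K : ℝ := (1 + ‖z‖) / z.im + 1 with hK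
  have hK0 : 0 < K := by positivity
  -- comparison of the two kernels with `1 + ‖w‖`
  have hconj : ∀ w : ℂ, 0 ≤ w.im → 1 + ‖w‖ ≤ K * ‖w - conj z‖ := fun w hw =>
    one_add_norm_le_mul_norm_sub hz (by simp) (by
      refine le_trans ?_ (Complex.abs_im_le_norm _)
      rw [Complex.sub_im, Complex.conj_im, sub_neg_eq_add]
      exact (by linarith : z.im ≤ w.im + z.im).trans (le_abs_self _))
  have hreal : ∀ x : ℝ, 1 + |x| ≤ K * ‖(x : ℂ) - z‖ := fun x => by
    have := one_add_norm_le_mul_norm_sub (w := x) hz (le_refl ‖z‖) (by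
      refine le_trans ?_ (Complex.abs_im_le_norm _)
      simp [le_abs_self])
    rwa [Complex.norm_real, Real.norm_eq_abs] at this
  have hne : ∀ w : ℂ, 0 ≤ w.im → w - conj z ≠ 0 := fun w hw h0 => by
    have := hconj w hw
    rw [h0, norm_zero, mul_zero] at this
    linarith [norm_nonneg w]
  have hner : ∀ x : ℝ, (x : ℂ) - z ≠ 0 := fun x h0 => by
    have := hreal x
    rw [h0, norm_zero, mul_zero] at this
    linarith [abs_nonneg x]
  have hFcont : Continuous fun x : ℝ => F x :=
    hd.continuousOn.comp_continuous Complex.continuous_ofReal (fun x => by simp)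
  have hint1 : Integrable fun x : ℝ => F x / (x - conj z) := by
    refine integrable_of_norm_le_inv_sq (C := C * K) ?_ fun x => ?_
    · exact (hFcont.div (by fun_prop) (fun x => hne x (by simp))).aestronglyMeasurable
    · have h1 := hb x (by simp)
      have h2 := hconj x (by simp)
      have h3 := norm_pos_iff.2 (hne x (by simp))
      rw [Complex.norm_real, Real.norm_eq_abs] at h1 h2
      have : 0 ≤ |x| := abs_nonneg x
      rw [norm_div, div_le_div_iff₀ h3 (by positivity)]
      rw [le_div_iff₀ (by positivity)] at h1
      calc ‖F x‖ * (1 + |x|) ^ 2 = (‖F x‖ * (1 + |x|)) * (1 + |x|) := by ring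
        _ ≤ C * (K * ‖(x : ℂ) - conj z‖) := by gcongr
        _ = _ := by ring
  have hint2 : Integrable fun x : ℝ => F x / (x - z) := by
    refine integrable_of_norm_le_inv_sq (C := C * K) ?_ fun x => ?_
    · exact (hFcont.div (by fun_prop) hner).aestronglyMeasurable
    · have h1 := hb x (by simp)
      have h2 := hreal x
      have h3 := norm_pos_iff.2 (hner x)
      rw [Complex.norm_real, Real.norm_eq_abs] at h1
      have : 0 ≤ |x| := abs_nonneg x
      rw [norm_div, div_le_div_iff₀ h3 (by positivity)]
      rw [le_div_iff₀ (by positivity)] at h1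
      calc ‖F x‖ * (1 + |x|) ^ 2 = (‖F x‖ * (1 + |x|)) * (1 + |x|) := by ring
        _ ≤ C * (K * ‖(x : ℂ) - z‖) := by gcongr
        _ = _ := by ring
  have hzero : ∫ x : ℝ, F x / (x - conj z) = 0 := by
    refine integral_eq_zero_of_differentiableOn_upperHalfPlane (Q := fun w => F w / (w - conj z))
      (R := 1) (C := C * K)
      (hd.div (by fun_prop) hne) (fun w hw h1w => ?_) hint1
    have h1 := hb w hw
    have h2 := hconj w hw
    have h3 := norm_pos_iff.2 (hne w hw)
    rw [norm_div, div_le_div_iff₀ h3 (by positivity)]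
    rw [le_div_iff₀ (by positivity)] at h1
    calc ‖F w‖ * ‖w‖ ^ 2 = (‖F w‖ * ‖w‖) * ‖w‖ := by ring
      _ ≤ (‖F w‖ * (1 + ‖w‖)) * (1 + ‖w‖) := by gcongr <;> linarith
      _ ≤ C * (K * ‖w - conj z‖) := by gcongr
      _ = _ := by ring
  have hnhds : {w : ℂ | 0 ≤ w.im} ∈ 𝓝 z :=
    mem_of_superset ((isOpen_lt continuous_const Complex.continuous_im).mem_nhds hz)
      (fun w (hw : 0 < w.im) => hw.le)
  obtain ⟨hPint, hPval⟩ := integral_poissonKernel hz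
  have hsplit : ∀ x : ℝ, dslope F z x / (x - conj z) =
      (1 / (2 * z.im * Complex.I)) * (F x / (x - z)) -
        (1 / (2 * z.im * Complex.I)) * (F x / (x - conj z)) -
        F z * (((x : ℂ) - z) * (x - conj z))⁻¹ := by
    intro x
    have h1 := hner x
    have h2 := hne x (by simp)
    have h3 : (z.im : ℂ) ≠ 0 := by exact_mod_cast hz.ne'
    have h4 : z - conj z = 2 * z.im * Complex.I := by
      rw [Complex.sub_conj]; push_cast; ring
    rw [dslope_of_ne _ (sub_ne_zero.1 h1), slope_def_field, ← h4]
    have h5 : z - conj z ≠ 0 := by rw [h4]; simp [h3]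
    field_simp
    ring
  have hint3 : Integrable fun x : ℝ => dslope F z x / (x - conj z) := by
    simp_rw [hsplit]
    exact ((hint2.const_mul _).sub (hint1.const_mul _)).sub (hPint.const_mul _)
  -- the divided difference removes the singularity at `z`; the radius `2 ‖z‖ + 1` keeps `w` away
  -- from `z` in the decay estimate
  have hzero' : ∫ x : ℝ, dslope F z x / (x - conj z) = 0 := by
    refine integral_eq_zero_of_differentiableOn_upperHalfPlane
      (Q := fun w => dslope F z w / (w - conj z))
      (R := 2 * ‖z‖ + 1) (C := 4 * C * K)
      (((Complex.differentiableOn_dslope hnhds).2 hd).div (by fun_prop) hne)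
      (fun w hw hRw => ?_) hint3
    have hwz : ‖w‖ / 2 ≤ ‖w - z‖ := by
      have := norm_sub_norm_le w z
      linarith [norm_nonneg z]
    have hw0 : 0 < ‖w‖ := by linarith [norm_nonneg z]
    have hwz0 : 0 < ‖w - z‖ := by linarith
    have hFle : ∀ u : ℂ, 0 ≤ u.im → ‖F u‖ ≤ C := fun u hu =>
      (hb u hu).trans (div_le_self hC (by linarith [norm_nonneg u]))
    have h2 := hconj w hw
    have h3 := norm_pos_iff.2 (hne w hw)
    have h4 : ‖F w - F z‖ ≤ 2 * C := by
      refine (norm_sub_le _ _).trans ?_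
      linarith [hFle w hw, hFle z hz.le]
    rw [dslope_of_ne _ (sub_ne_zero.1 (norm_pos_iff.1 hwz0)), slope_def_field, norm_div, norm_div,
      div_div, div_le_div_iff₀ (by positivity) (by positivity)]
    calc ‖F w - F z‖ * ‖w‖ ^ 2 ≤ (2 * C) * ((2 * ‖w - z‖) * (K * ‖w - conj z‖)) := by
          rw [sq]; gcongr <;> linarith
      _ = _ := by ring
  have hcauchy : ∫ x : ℝ, F x / (x - z) = 2 * Real.pi * Complex.I * F z := by
    simp_rw [hsplit] at hzero'
    have hdiff : Integrable fun x : ℝ => 1 / (2 * z.im * Complex.I) * (F x / (x - z)) -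
        1 / (2 * z.im * Complex.I) * (F x / (x - conj z)) :=
      (hint2.const_mul _).sub (hint1.const_mul _)
    rw [integral_sub hdiff (hPint.const_mul _),
      integral_sub (hint2.const_mul _) (hint1.const_mul _), integral_const_mul,
      integral_const_mul, integral_const_mul, hzero, hPval] at hzero'
    have h3 : (z.im : ℂ) ≠ 0 := by exact_mod_cast hz.ne'
    have hI := Complex.I_ne_zero
    field_simp at hzero'
    linear_combination hzero'
  have hconjint : Integrable fun x : ℝ => conj (F x) / ((x : ℂ) - z) := by
    have := (Complex.conjCLE.toContinuousLinearMap.integrable_comp hint1)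
    simpa using this
  have hconjzero : ∫ x : ℝ, conj (F x) / ((x : ℂ) - z) = 0 := by
    have h := congrArg conj hzero
    rw [← integral_conj, map_zero] at h
    simpa using h
  have him : ∀ x : ℝ, ((F x).im : ℂ) / (x - z) =
      (1 / (2 * Complex.I)) * (F x / (x - z) - conj (F x) / (x - z)) := by
    intro x
    have h1 := Complex.sub_conj (F x)
    rw [← sub_div, h1]
    push_cast
    field_simp
  simp_rw [him]
  rw [integral_const_mul, integral_sub hint2 hconjint, hcauchy, hconjzero]
  have : (Real.pi : ℂ) ≠ 0 := by exact_mod_cast Real.pi_ne_zero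
  field_simp
  ring

/-! ### Stieltjes inversion -/

theorem abs_im_le_norm_ofReal_sub (z : ℂ) (x : ℝ) : |z.im| ≤ ‖(x : ℂ) - z‖ := by
  refine le_trans ?_ (Complex.abs_im_le_norm _)
  simp

theorem integrable_one_div_ofReal_sub (μ : Measure ℝ) [IsFiniteMeasure μ] {z : ℂ}
    (hz : z.im ≠ 0) : Integrable (fun x : ℝ => 1 / ((x : ℂ) - z)) μ := by
  refine Integrable.of_bound (C := 1 / |z.im|)
    (by fun_prop : Measurable fun x : ℝ => 1 / ((x : ℂ) - z)).aestronglyMeasurable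
    (Eventually.of_forall fun x => ?_)
  rw [norm_div, norm_one]
  have := abs_im_le_norm_ofReal_sub z x
  have := abs_pos.2 hz
  gcongr

theorem cauchyPDFReal_zero_mul {y : ℝ} (hy : 0 < y) (u : ℝ) :
    cauchyPDFReal 0 y.toNNReal (y * u) = y⁻¹ * cauchyPDFReal 0 1 u := by
  simp only [cauchyPDFReal_def, Real.coe_toNNReal _ hy.le, NNReal.coe_one]
  field_simp
  ring

/-- Up to the factor `π` the imaginary part of the Stieltjes transform at height `y` is the convolution of
the measure with the Cauchy density of scale `y`. -/
theorem im_stieltjesTransform (μ : Measure ℝ) [IsFiniteMeasure μ] (x : ℝ) {y : ℝ} (hy : 0 < y) :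
    (stieltjesTransform μ (x + y * Complex.I)).im =
      Real.pi * ∫ t : ℝ, cauchyPDFReal 0 y.toNNReal (x - t) ∂μ := by
  rw [stieltjesTransform_eq, ← integral_const_mul]
  have h := integrable_one_div_ofReal_sub μ (z := x + y * Complex.I) (by simpa using hy.ne')
  refine (integral_im h).symm.trans (integral_congr_ae (Eventually.of_forall fun t => ?_))
  have h1 : (t - x) ^ 2 + y ^ 2 ≠ 0 := by positivity
  have h2 : (x - t) ^ 2 + y ^ 2 ≠ 0 := by positivity
  simp only [cauchyPDFReal_def, Real.coe_toNNReal _ hy.le, one_div]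
  change Complex.im _ = _
  rw [Complex.inv_im]
  simp [Complex.normSq_apply]
  field_simp
  ring

open BoundedContinuousFunction in
/-- Stieltjes inversion, in the sense of weak convergence: after Fubini and the substitution `x = t + y u`
the integral is `∫ ∫ φ (t + y u) k(u) du μ(dt)` with `k` the standard Cauchy density. -/
theorem tendsto_integral_mul_im_stieltjesTransform (μ : Measure ℝ) [IsProbabilityMeasure μ]
    (φ : ℝ →ᵇ ℝ) :
    Tendsto
      (fun y : ℝ => ∫ x : ℝ, φ x * ((stieltjesTransform μ (x + y * Complex.I)).im / Real.pi))
      (𝓝[>] 0) (𝓝 (∫ t, φ t ∂μ)) := by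
  have hφm : Measurable φ := φ.continuous.measurable
  have hone : ∫ u : ℝ, cauchyPDFReal 0 1 u = 1 := integral_cauchyPDFReal_eq_one 0 one_ne_zero
  have hnn : ∀ u, 0 ≤ cauchyPDFReal 0 1 u := fun u => (cauchyPDF_pos 0 one_ne_zero u).le
  have hkey : ∀ y : ℝ, 0 < y →
      ∫ x : ℝ, φ x * ((stieltjesTransform μ (x + y * Complex.I)).im / Real.pi) =
        ∫ t : ℝ, (∫ u : ℝ, φ (t + y * u) * cauchyPDFReal 0 1 u) ∂μ := by
    intro y hy
    have hconv : Integrable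
        (fun p : ℝ × ℝ => φ p.1 * cauchyPDFReal 0 y.toNNReal (p.1 - p.2)) (volume.prod μ) := by
      have h0 := (integrable_const (1 : ℝ) (μ := μ)).convolution_integrand
        (ContinuousLinearMap.mul ℝ ℝ) (integrable_cauchyPDFReal 0 (γ := y.toNNReal))
      simp only [ContinuousLinearMap.mul_apply', one_mul] at h0
      exact h0.bdd_mul (hφm.comp measurable_fst).aestronglyMeasurable
        (Eventually.of_forall fun p => φ.norm_coe_le_norm p.1)
    calc _ = ∫ x : ℝ, ∫ t : ℝ, φ x * cauchyPDFReal 0 y.toNNReal (x - t) ∂μ := by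
          refine integral_congr_ae (Eventually.of_forall fun x => ?_)
          simp only
          rw [im_stieltjesTransform μ x hy, mul_div_cancel_left₀ _ Real.pi_ne_zero,
            integral_const_mul]
      _ = ∫ t : ℝ, (∫ x : ℝ, φ x * cauchyPDFReal 0 y.toNNReal (x - t)) ∂μ :=
          integral_integral_swap hconv
      _ = _ := by
          refine integral_congr_ae (Eventually.of_forall fun t => ?_)
          simp only
          have h1 := integral_add_left_eq_self
            (fun x => φ x * cauchyPDFReal 0 y.toNNReal (x - t)) (μ := volume) t
          have h2 := Measure.integral_comp_mul_left
            (fun x => φ (t + x) * cauchyPDFReal 0 y.toNNReal (t + x - t)) y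
          rw [← h1]
          simp only [add_sub_cancel_left, cauchyPDFReal_zero_mul hy, smul_eq_mul] at h2 ⊢
          rw [abs_of_pos (inv_pos.2 hy)] at h2
          have h3 : ∀ x, φ (t + y * x) * (y⁻¹ * cauchyPDFReal 0 1 x) =
              y⁻¹ * (φ (t + y * x) * cauchyPDFReal 0 1 x) := fun x => by ring
          simp_rw [h3, integral_const_mul] at h2
          exact (mul_left_cancel₀ (inv_pos.2 hy).ne' h2).symm
  refine Tendsto.congr' (f₁ := fun y : ℝ =>
    ∫ t : ℝ, (∫ u : ℝ, φ (t + y * u) * cauchyPDFReal 0 1 u) ∂μ)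
    (eventually_mem_nhdsWithin.mono fun y hy => (hkey y hy).symm) ?_
  have hbd : ∀ (y t u : ℝ),
      ‖φ (t + y * u) * cauchyPDFReal 0 1 u‖ ≤ ‖φ‖ * cauchyPDFReal 0 1 u := by
    intro y t u
    rw [norm_mul, Real.norm_of_nonneg (hnn u)]
    exact mul_le_mul_of_nonneg_right (φ.norm_coe_le_norm _) (hnn u)
  have hmeas : ∀ y : ℝ, StronglyMeasurable
      (fun p : ℝ × ℝ => φ (p.1 + y * p.2) * cauchyPDFReal 0 1 p.2) := fun y =>
    Measurable.stronglyMeasurable (by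
      have := measurable_cauchyPDFReal 0 1
      fun_prop)
  refine tendsto_integral_filter_of_dominated_convergence (fun _ => ‖φ‖) ?_ ?_
    (integrable_const _) ?_
  · exact Eventually.of_forall fun y => (hmeas y).integral_prod_right.aestronglyMeasurable
  · refine Eventually.of_forall fun y => Eventually.of_forall fun t => ?_
    refine (norm_integral_le_of_norm_le ((integrable_cauchyPDFReal 0).const_mul ‖φ‖)
      (Eventually.of_forall fun u => hbd y t u)).trans ?_
    rw [integral_const_mul, hone, mul_one]
  · refine Eventually.of_forall fun t => ?_
    have : Tendsto (fun y : ℝ => ∫ u : ℝ, φ (t + y * u) * cauchyPDFReal 0 1 u) (𝓝[>] 0)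
        (𝓝 (∫ u : ℝ, φ t * cauchyPDFReal 0 1 u)) := by
      refine tendsto_integral_filter_of_dominated_convergence
        (fun u => ‖φ‖ * cauchyPDFReal 0 1 u) ?_ ?_
        ((integrable_cauchyPDFReal 0).const_mul ‖φ‖) ?_
      · exact Eventually.of_forall fun y =>
          ((hmeas y).comp_measurable (measurable_const.prodMk measurable_id)).aestronglyMeasurable
      · exact Eventually.of_forall fun y => Eventually.of_forall fun u => hbd y t u
      · refine Eventually.of_forall fun u => ?_
        refine Tendsto.mul_const _ ((φ.continuous.tendsto t).comp ?_)
        have : Tendsto (fun y : ℝ => t + y * u) (𝓝 0) (𝓝 (t + 0 * u)) :=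
          Continuous.tendsto (by fun_prop) 0
        simp only [zero_mul, add_zero] at this
        exact this.mono_left nhdsWithin_le_nhds
    rwa [integral_const_mul, hone, mul_one] at this

theorem eq_of_stieltjesTransform_eq {μ μ' : Measure ℝ} [IsProbabilityMeasure μ]
    [IsProbabilityMeasure μ']
    (h : ∀ z : ℂ, 0 < z.im → stieltjesTransform μ z = stieltjesTransform μ' z) : μ = μ' := by
  refine ext_of_forall_integral_eq_of_IsFiniteMeasure fun φ => ?_
  refine tendsto_nhds_unique (tendsto_integral_mul_im_stieltjesTransform μ φ)
    ((tendsto_integral_mul_im_stieltjesTransform μ' φ).congr' ?_)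
  refine eventually_mem_nhdsWithin.mono fun y (hy : 0 < y) => ?_
  refine integral_congr_ae (Eventually.of_forall fun x => ?_)
  simp only
  rw [h _ (by simpa using hy)]

/-! ### Power potentials of a measure -/

/-- The complex power potential `∫ (z - x)^p ν(dx)`, with the principal branch of the power. -/
noncomputable def cpowPotential (ν : Measure ℝ) (p : ℝ) (z : ℂ) : ℂ :=
  ∫ x : ℝ, (z - (x : ℂ)) ^ (p : ℂ) ∂ν

/-- The absolute power potential `∫ |z - x|^p ν(dx)`. -/
noncomputable def absPotential (ν : Measure ℝ) (p : ℝ) (z : ℂ) : ℝ :=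
  ∫ x : ℝ, ‖z - (x : ℂ)‖ ^ p ∂ν

theorem quadFormTransform_eq (ν : Measure ℝ) (α : ℝ) (z : ℂ) :
    quadFormTransform ν α z =
      -(cpowPotential ν (α / 2 - 1) z / cpowPotential ν (α / 2) z) := by
  simp [quadFormTransform, cpowPotential]

theorem measurable_sub_cpow (z : ℂ) (p : ℝ) :
    Measurable fun x : ℝ => (z - (x : ℂ)) ^ (p : ℂ) := by fun_prop

theorem measurable_norm_sub_rpow (z : ℂ) (p : ℝ) :
    Measurable fun x : ℝ => ‖z - (x : ℂ)‖ ^ p := by fun_prop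

theorem norm_cpowPotential_le (ν : Measure ℝ) (p : ℝ) (z : ℂ) :
    ‖cpowPotential ν p z‖ ≤ absPotential ν p z := by
  refine (norm_integral_le_integral_norm _).trans_eq ?_
  simp_rw [Complex.norm_cpow_real]
  rfl

theorem absPotential_nonneg (ν : Measure ℝ) (p : ℝ) (z : ℂ) : 0 ≤ absPotential ν p z :=
  integral_nonneg fun _ => by positivity

theorem rpow_le_rpow_add_rpow {δ t T p : ℝ} (hδ : 0 < δ) (h1 : δ ≤ t) (h2 : t ≤ T) :
    t ^ p ≤ δ ^ p + T ^ p := by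
  have ht : 0 < t := hδ.trans_le h1
  have hT : 0 < T := ht.trans_le h2
  rcases le_total 0 p with hp | hp
  · have := Real.rpow_le_rpow ht.le h2 hp
    have := Real.rpow_nonneg hδ.le p
    linarith
  · have := Real.rpow_le_rpow_of_nonpos hδ h1 hp
    have := Real.rpow_nonneg hT.le p
    linarith

theorem norm_sub_ofReal_le {R x : ℝ} (hx : |x| ≤ R) (z : ℂ) : ‖z - (x : ℂ)‖ ≤ ‖z‖ + R := by
  refine (norm_sub_le _ _).trans ?_
  rw [Complex.norm_real, Real.norm_eq_abs]
  linarith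

theorem integrable_norm_sub_rpow {ν : Measure ℝ} [IsFiniteMeasure ν] {R p : ℝ} (hp : 0 ≤ p)
    (hR : ∀ᵐ x ∂ν, |x| ≤ R) (z : ℂ) : Integrable (fun x : ℝ => ‖z - (x : ℂ)‖ ^ p) ν := by
  refine Integrable.of_bound (C := (‖z‖ + R) ^ p)
    (measurable_norm_sub_rpow z p).aestronglyMeasurable (hR.mono fun x hx => ?_)
  rw [Real.norm_of_nonneg (by positivity)]
  exact Real.rpow_le_rpow (norm_nonneg _) (norm_sub_ofReal_le hx z) hp

theorem integrable_sub_cpow_iff {ν : Measure ℝ} {p : ℝ} {z : ℂ} :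
    Integrable (fun x : ℝ => (z - (x : ℂ)) ^ (p : ℂ)) ν ↔
      Integrable (fun x : ℝ => ‖z - (x : ℂ)‖ ^ p) ν := by
  rw [← integrable_norm_iff (measurable_sub_cpow z p).aestronglyMeasurable]
  simp_rw [Complex.norm_cpow_real]

theorem integrable_norm_sub_rpow_of_le {ν : Measure ℝ} [IsFiniteMeasure ν] {R δ p : ℝ} {z : ℂ}
    (hR : ∀ᵐ x ∂ν, |x| ≤ R) (hδ : 0 < δ) (h : ∀ᵐ x : ℝ ∂ν, δ ≤ ‖z - (x : ℂ)‖) :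
    Integrable (fun x : ℝ => ‖z - (x : ℂ)‖ ^ p) ν := by
  refine Integrable.of_bound (C := δ ^ p + (‖z‖ + R) ^ p)
    (measurable_norm_sub_rpow z p).aestronglyMeasurable ?_
  filter_upwards [hR, h] with x hx hδx
  rw [Real.norm_of_nonneg (by positivity)]
  exact rpow_le_rpow_add_rpow hδ hδx (norm_sub_ofReal_le hx z)

/-! ### Lower bounds for the power potential -/

/-- On the closed upper half plane the values of `w ↦ w ^ a` lie in the sector of opening `π a`
around the direction `exp (i π a / 2)`. -/
theorem cos_mul_norm_rpow_le_re {a : ℝ} (ha0 : 0 < a) (ha1 : a < 1) {w : ℂ} (hw : 0 ≤ w.im) :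
    Real.cos (Real.pi * a / 2) * ‖w‖ ^ a ≤
      (Complex.exp (-(Real.pi * a / 2 : ℝ) * Complex.I) * w ^ (a : ℂ)).re := by
  rcases eq_or_ne w 0 with rfl | hw0
  · simp [Real.zero_rpow ha0.ne', Complex.zero_cpow (Complex.ofReal_ne_zero.2 ha0.ne')]
  have hre : (-(Real.pi * a / 2 : ℝ) * Complex.I + Complex.log w * a : ℂ).re =
      Real.log ‖w‖ * a := by simp [Complex.log_re]
  have him : (-(Real.pi * a / 2 : ℝ) * Complex.I + Complex.log w * a : ℂ).im =
      w.arg * a - Real.pi * a / 2 := by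
    simp [Complex.log_im]; ring
  rw [Complex.cpow_def_of_ne_zero hw0, ← Complex.exp_add, Complex.exp_re, hre, him,
    ← Real.rpow_def_of_pos (norm_pos_iff.2 hw0), mul_comm]
  refine mul_le_mul_of_nonneg_left ?_ (by positivity)
  have harg0 : 0 ≤ w.arg := Complex.arg_nonneg_iff.2 hw
  have harg1 : w.arg ≤ Real.pi := Complex.arg_le_pi w
  have hpi := Real.pi_pos
  rw [← Real.cos_abs (w.arg * a - Real.pi * a / 2)]
  refine Real.cos_le_cos_of_nonneg_of_le_pi (abs_nonneg _) (by nlinarith) ?_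
  rw [abs_le]
  constructor <;> nlinarith [mul_nonneg harg0 ha0.le, mul_le_mul_of_nonneg_right harg1 ha0.le]

theorem cos_pi_mul_div_two_pos {a : ℝ} (ha0 : 0 < a) (ha1 : a < 1) :
    0 < Real.cos (Real.pi * a / 2) := by
  have hpi := Real.pi_pos
  exact Real.cos_pos_of_mem_Ioo ⟨by nlinarith, by nlinarith⟩

theorem cos_mul_absPotential_le_norm {ν : Measure ℝ} [IsFiniteMeasure ν] {R a : ℝ} (ha0 : 0 < a)
    (ha1 : a < 1) (hR : ∀ᵐ x ∂ν, |x| ≤ R) {z : ℂ} (hz : 0 ≤ z.im) :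
    Real.cos (Real.pi * a / 2) * absPotential ν a z ≤ ‖cpowPotential ν a z‖ := by
  have hint := integrable_norm_sub_rpow ha0.le hR z
  have hcint := (integrable_sub_cpow_iff.2 hint).const_mul
    (Complex.exp (-(Real.pi * a / 2 : ℝ) * Complex.I))
  calc Real.cos (Real.pi * a / 2) * absPotential ν a z
      ≤ ∫ x : ℝ, (Complex.exp (-(Real.pi * a / 2 : ℝ) * Complex.I) *
          (z - (x : ℂ)) ^ (a : ℂ)).re ∂ν := by
        rw [absPotential, ← integral_const_mul]
        exact integral_mono (hint.const_mul _) hcint.re fun x =>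
          cos_mul_norm_rpow_le_re ha0 ha1 (by simpa using hz)
    _ = (Complex.exp (-(Real.pi * a / 2 : ℝ) * Complex.I) * cpowPotential ν a z).re := by
        rw [cpowPotential, ← integral_const_mul]
        exact integral_re hcint
    _ ≤ ‖cpowPotential ν a z‖ := by
        refine (Complex.re_le_norm _).trans_eq ?_
        rw [norm_mul, ← Complex.ofReal_neg, Complex.norm_exp_ofReal_mul_I, one_mul]

theorem sInf_support_mem {ν : Measure ℝ} [IsProbabilityMeasure ν]
    (hbdd : Bornology.IsBounded ν.support) : sInf ν.support ∈ ν.support :=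
  (Metric.isCompact_of_isClosed_isBounded Measure.isClosed_support hbdd).sInf_mem
    (Measure.nonempty_support (IsProbabilityMeasure.ne_zero ν))

theorem sSup_support_mem {ν : Measure ℝ} [IsProbabilityMeasure ν]
    (hbdd : Bornology.IsBounded ν.support) : sSup ν.support ∈ ν.support :=
  (Metric.isCompact_of_isClosed_isBounded Measure.isClosed_support hbdd).sSup_mem
    (Measure.nonempty_support (IsProbabilityMeasure.ne_zero ν))

theorem ae_mem_Icc_support {ν : Measure ℝ} (hbdd : Bornology.IsBounded ν.support) :
    ∀ᵐ x ∂ν, x ∈ Set.Icc (sInf ν.support) (sSup ν.support) :=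
  Filter.Eventually.mono (Measure.support_mem_ae (μ := ν)) fun _ hx =>
    ⟨csInf_le hbdd.bddBelow hx, le_csSup hbdd.bddAbove hx⟩

theorem sInf_support_lt_sSup_support {ν : Measure ℝ} [IsProbabilityMeasure ν]
    (hbdd : Bornology.IsBounded ν.support) (hnondeg : ∀ b : ℝ, ν ≠ Measure.dirac b) :
    sInf ν.support < sSup ν.support := by
  by_contra hle
  refine hnondeg (sInf ν.support) ?_
  have hae : (id : ℝ → ℝ) =ᵐ[ν] fun _ => sInf ν.support :=
    (ae_mem_Icc_support hbdd).mono fun x hx => le_antisymm (hx.2.trans (not_lt.1 hle)) hx.1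
  have h : ν.map id = ν.map fun _ => sInf ν.support := Measure.map_congr hae
  rw [Measure.map_id, Measure.map_const] at h
  simpa using h

/-- A non-degenerate measure has two points in its support, and no `z` is close to both of them. -/
theorem exists_pos_le_absPotential {ν : Measure ℝ} [IsProbabilityMeasure ν]
    (hbdd : Bornology.IsBounded ν.support) (hnondeg : ∀ b : ℝ, ν ≠ Measure.dirac b) {R a : ℝ}
    (ha0 : 0 < a) (hR : ∀ᵐ x ∂ν, |x| ≤ R) :
    ∃ c : ℝ, 0 < c ∧ ∀ z : ℂ, c ≤ absPotential ν a z := by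
  have hlt := sInf_support_lt_sSup_support hbdd hnondeg
  set m := sInf ν.support
  set M := sSup ν.support
  set d := (M - m) / 4 with hd
  have hd0 : 0 < d := by simp only [hd]; linarith
  have hpos : ∀ p ∈ ν.support, 0 < ν.real (Metric.ball p d) := fun p hp =>
    ENNReal.toReal_pos ((Measure.mem_support_iff_forall p).1 hp _ (Metric.ball_mem_nhds p hd0)).ne'
      (measure_ne_top _ _)
  have hm := hpos m (sInf_support_mem hbdd)
  have hM := hpos M (sSup_support_mem hbdd)
  have hball : ∀ (z : ℂ) (p : ℝ), (∀ y ∈ Metric.ball p d, d ≤ ‖z - (y : ℂ)‖) →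
      d ^ a * ν.real (Metric.ball p d) ≤ absPotential ν a z := by
    intro z p h
    have hint := integrable_norm_sub_rpow ha0.le hR z
    calc d ^ a * ν.real (Metric.ball p d) ≤ ∫ x in Metric.ball p d, ‖z - (x : ℂ)‖ ^ a ∂ν := by
          refine setIntegral_ge_of_const_le_real Metric.isOpen_ball.measurableSet
            (measure_ne_top _ _) (fun y hy => ?_) hint.integrableOn
          exact Real.rpow_le_rpow hd0.le (h y hy) ha0.le
      _ ≤ absPotential ν a z :=
          setIntegral_le_integral hint (Eventually.of_forall fun _ => by positivity)
  refine ⟨d ^ a * min (ν.real (Metric.ball m d)) (ν.real (Metric.ball M d)),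
    mul_pos (Real.rpow_pos_of_pos hd0 a) (lt_min hm hM), fun z => ?_⟩
  have hda := Real.rpow_nonneg hd0.le a
  -- the point `z` is at distance at least `d` from one of the two balls around the endpoints
  have hre : ∀ y : ℝ, |z.re - y| ≤ ‖z - (y : ℂ)‖ := fun y => by
    simpa using Complex.abs_re_le_norm (z - (y : ℂ))
  rcases le_total ((m + M) / 2) z.re with hz | hz
  · refine (mul_le_mul_of_nonneg_left (min_le_left _ _) hda).trans (hball z m fun y hy => ?_)
    rw [Metric.mem_ball, Real.dist_eq, abs_lt] at hy
    refine le_trans ?_ ((le_abs_self _).trans (hre y))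
    linarith [hy.2]
  · refine (mul_le_mul_of_nonneg_left (min_le_right _ _) hda).trans (hball z M fun y hy => ?_)
    rw [Metric.mem_ball, Real.dist_eq, abs_lt] at hy
    refine le_trans ?_ ((neg_le_abs _).trans (hre y))
    linarith [hy.1]

/-! ### Decay of the quotient of two power potentials -/

/-- If `z` is at distance comparable to `1 + ‖z‖` from the support, lowering the exponent by one gains a
factor of order `1 / (1 + ‖z‖)`. -/
theorem absPotential_sub_one_le {ν : Measure ℝ} [IsFiniteMeasure ν] {R a K : ℝ} (ha0 : 0 < a)
    (hR : ∀ᵐ x ∂ν, |x| ≤ R) {z : ℂ} (hK : ∀ᵐ x : ℝ ∂ν, 1 + ‖z‖ ≤ K * ‖z - (x : ℂ)‖) :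
    Integrable (fun x : ℝ => ‖z - (x : ℂ)‖ ^ (a - 1)) ν ∧
      absPotential ν (a - 1) z ≤ K / (1 + ‖z‖) * absPotential ν a z := by
  have hint := (integrable_norm_sub_rpow ha0.le hR z).const_mul (K / (1 + ‖z‖))
  have hle : ∀ᵐ x : ℝ ∂ν, ‖z - (x : ℂ)‖ ^ (a - 1) ≤ K / (1 + ‖z‖) * ‖z - (x : ℂ)‖ ^ a := by
    filter_upwards [hK] with x hx
    have h1 : 0 < 1 + ‖z‖ := by positivity
    have h2 : 0 < ‖z - (x : ℂ)‖ := by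
      refine (norm_nonneg _).lt_of_ne fun h0 => ?_
      rw [← h0, mul_zero] at hx
      linarith
    have h3 := Real.rpow_nonneg h2.le a
    rw [Real.rpow_sub_one h2.ne', div_mul_eq_mul_div, div_le_div_iff₀ h2 h1]
    nlinarith
  refine ⟨hint.mono' (measurable_norm_sub_rpow z _).aestronglyMeasurable
    (hle.mono fun x hx => by rwa [Real.norm_of_nonneg (by positivity)]), ?_⟩
  rw [absPotential, absPotential, ← integral_const_mul]
  exact integral_mono_of_nonneg (Eventually.of_forall fun _ => by positivity) hint hle

theorem norm_cpowPotential_div_le {ν : Measure ℝ} [IsFiniteMeasure ν] {R a K : ℝ} (ha0 : 0 < a)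
    (ha1 : a < 1) (hR : ∀ᵐ x ∂ν, |x| ≤ R) {z : ℂ} (hz : 0 ≤ z.im)
    (hpos : 0 < absPotential ν a z) (hK : ∀ᵐ x : ℝ ∂ν, 1 + ‖z‖ ≤ K * ‖z - (x : ℂ)‖) :
    ‖cpowPotential ν (a - 1) z / cpowPotential ν a z‖ ≤
      K / Real.cos (Real.pi * a / 2) / (1 + ‖z‖) := by
  have hc := cos_pi_mul_div_two_pos ha0 ha1
  have hG := cos_mul_absPotential_le_norm ha0 ha1 hR hz
  have hN := (norm_cpowPotential_le ν (a - 1) z).trans (absPotential_sub_one_le ha0 hR hK).2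
  have hG0 : 0 < ‖cpowPotential ν a z‖ := (mul_pos hc hpos).trans_le hG
  rw [norm_div, div_le_iff₀ hG0]
  refine hN.trans ?_
  have hK0 : 0 ≤ K / (1 + ‖z‖) := by
    by_contra hneg
    have h1 := mul_neg_of_neg_of_pos (not_le.1 hneg) hpos
    have h2 := (norm_nonneg _).trans hN
    linarith
  calc K / (1 + ‖z‖) * absPotential ν a z
      = K / Real.cos (Real.pi * a / 2) / (1 + ‖z‖) *
        (Real.cos (Real.pi * a / 2) * absPotential ν a z) := by field_simp
    _ ≤ _ := by
      refine mul_le_mul_of_nonneg_left hG ?_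
      rw [div_right_comm]
      positivity

/-- The quotient of the two potentials is asymptotic to `1 / z`, because
`z (z - x) ^ (a - 1) - (z - x) ^ a = x (z - x) ^ (a - 1)`. -/
theorem norm_mul_cpowPotential_div_sub_one_le {ν : Measure ℝ} [IsFiniteMeasure ν] {R a K : ℝ}
    (ha0 : 0 < a) (ha1 : a < 1) (hR : ∀ᵐ x ∂ν, |x| ≤ R) (hR0 : 0 ≤ R) {z : ℂ} (hz : 0 ≤ z.im)
    (hpos : 0 < absPotential ν a z) (hK : ∀ᵐ x : ℝ ∂ν, 1 + ‖z‖ ≤ K * ‖z - (x : ℂ)‖)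
    (hK0 : 0 ≤ K) :
    ‖z * (cpowPotential ν (a - 1) z / cpowPotential ν a z) - 1‖ ≤
      R * (K / Real.cos (Real.pi * a / 2) / (1 + ‖z‖)) := by
  have hc := cos_pi_mul_div_two_pos ha0 ha1
  have hG := cos_mul_absPotential_le_norm ha0 ha1 hR hz
  have hG0 : 0 < ‖cpowPotential ν a z‖ := (mul_pos hc hpos).trans_le hG
  obtain ⟨hint1, hN⟩ := absPotential_sub_one_le ha0 hR hK
  have hdiff : z * cpowPotential ν (a - 1) z - cpowPotential ν a z =
      ∫ x : ℝ, (x : ℂ) * (z - (x : ℂ)) ^ ((a - 1 : ℝ) : ℂ) ∂ν := by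
    rw [cpowPotential, cpowPotential, ← integral_const_mul,
      ← integral_sub ((integrable_sub_cpow_iff.2 hint1).const_mul z)
        (integrable_sub_cpow_iff.2 (integrable_norm_sub_rpow ha0.le hR z))]
    refine integral_congr_ae (hK.mono fun x hx => ?_)
    have hne : z - (x : ℂ) ≠ 0 := fun h0 => by
      rw [h0, norm_zero, mul_zero] at hx
      linarith [norm_nonneg z]
    simp only
    rw [Complex.ofReal_sub, Complex.ofReal_one, Complex.cpow_sub _ _ hne, Complex.cpow_one]
    field_simp
    ring
  have hdle : ‖z * cpowPotential ν (a - 1) z - cpowPotential ν a z‖ ≤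
      R * absPotential ν (a - 1) z := by
    rw [hdiff, absPotential, ← integral_const_mul]
    refine norm_integral_le_of_norm_le (hint1.const_mul R) (hR.mono fun x hx => ?_)
    rw [norm_mul, Complex.norm_cpow_real, Complex.norm_real, Real.norm_eq_abs]
    gcongr
  have hne : cpowPotential ν a z ≠ 0 := norm_pos_iff.1 hG0
  have heq : z * (cpowPotential ν (a - 1) z / cpowPotential ν a z) - 1 =
      (z * cpowPotential ν (a - 1) z - cpowPotential ν a z) / cpowPotential ν a z := by
    field_simp
  rw [heq, norm_div, div_le_iff₀ hG0]
  calc _ ≤ R * (K / (1 + ‖z‖) * absPotential ν a z) :=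
        hdle.trans (mul_le_mul_of_nonneg_left hN hR0)
    _ = R * (K / Real.cos (Real.pi * a / 2) / (1 + ‖z‖)) *
        (Real.cos (Real.pi * a / 2) * absPotential ν a z) := by field_simp
    _ ≤ _ := mul_le_mul_of_nonneg_left hG (by positivity)

/-! ### Holomorphy and boundary values of the power potential -/

theorem differentiableAt_cpowPotential {ν : Measure ℝ} [IsFiniteMeasure ν] {R p : ℝ}
    (hR : ∀ᵐ x ∂ν, |x| ≤ R) {z : ℂ} (hz : 0 < z.im) :
    DifferentiableAt ℂ (cpowPotential ν p) z := by
  set δ := z.im / 2 with hδ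
  have hδ0 : 0 < δ := by positivity
  have him : ∀ w ∈ Metric.ball z δ, δ ≤ w.im := fun w hw => by
    rw [Metric.mem_ball, Complex.dist_eq] at hw
    have := (neg_le_abs _).trans ((Complex.abs_im_le_norm (w - z)).trans hw.le)
    rw [Complex.sub_im] at this
    linarith
  have hlow : ∀ w ∈ Metric.ball z δ, ∀ x : ℝ, δ ≤ ‖w - (x : ℂ)‖ := fun w hw x => by
    refine (him w hw).trans ((le_abs_self _).trans ?_)
    simpa using Complex.abs_im_le_norm (w - (x : ℂ))
  have h := hasDerivAt_integral_of_dominated_loc_of_deriv_le (𝕜 := ℂ) (μ := ν) (x₀ := z)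
    (F := fun w (x : ℝ) => (w - (x : ℂ)) ^ (p : ℂ))
    (F' := fun w (x : ℝ) => (p : ℂ) * (w - (x : ℂ)) ^ ((p - 1 : ℝ) : ℂ))
    (bound := fun _ => |p| * (δ ^ (p - 1) + (‖z‖ + δ + R) ^ (p - 1)))
    (Metric.ball_mem_nhds z hδ0)
    (Eventually.of_forall fun w => (measurable_sub_cpow w p).aestronglyMeasurable)
    (integrable_sub_cpow_iff.2 (integrable_norm_sub_rpow_of_le hR hδ0
      (Eventually.of_forall (hlow z (Metric.mem_ball_self hδ0)))))
    ((measurable_sub_cpow z (p - 1)).const_mul _).aestronglyMeasurable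
    (hR.mono fun x hx w hw => ?_) (integrable_const _)
    (Eventually.of_forall fun x w hw => ?_)
  · exact h.2.differentiableAt
  · rw [norm_mul, Complex.norm_cpow_real, Complex.norm_real, Real.norm_eq_abs]
    refine mul_le_mul_of_nonneg_left ?_ (abs_nonneg p)
    refine rpow_le_rpow_add_rpow hδ0 (hlow w hw x) ((norm_sub_ofReal_le hx w).trans ?_)
    have h1 : ‖w‖ ≤ ‖w - z‖ + ‖z‖ := by simpa using norm_add_le (w - z) z
    rw [Metric.mem_ball, Complex.dist_eq] at hw
    linarith
  · have h1 : HasDerivAt (fun w : ℂ => w - (x : ℂ)) 1 w := (hasDerivAt_id w).sub_const _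
    have h2 := h1.cpow_const (c := (p : ℂ)) (Or.inr (by
      have := him w hw
      simp
      linarith))
    simpa using h2

/-- For `t < 0` the principal branch at `t` is continuous from above, since its argument there is `π`. -/
theorem tendsto_add_mul_I_cpow {t p : ℝ} (ht : t ≠ 0) :
    Tendsto (fun ε : ℝ => ((t : ℂ) + ε * Complex.I) ^ (p : ℂ)) (𝓝[>] 0) (𝓝 ((t : ℂ) ^ (p : ℂ))) := by
  have hpath : Tendsto (fun ε : ℝ => (t : ℂ) + ε * Complex.I) (𝓝[>] 0)
      (𝓝[{w : ℂ | 0 ≤ w.im}] (t : ℂ)) := by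
    refine tendsto_nhdsWithin_iff.2 ⟨?_, eventually_mem_nhdsWithin.mono fun ε (hε : 0 < ε) => ?_⟩
    · have : Tendsto (fun ε : ℝ => (t : ℂ) + ε * Complex.I) (𝓝 0)
          (𝓝 ((t : ℂ) + (0 : ℝ) * Complex.I)) := Continuous.tendsto (by fun_prop) 0
      rw [Complex.ofReal_zero, zero_mul, add_zero] at this
      exact this.mono_left nhdsWithin_le_nhds
    · simpa using hε.le
  have hlog : Tendsto (fun ε : ℝ => Complex.log ((t : ℂ) + ε * Complex.I)) (𝓝[>] 0)
      (𝓝 (Complex.log t)) := by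
    rcases lt_or_gt_of_ne ht with h | h
    · exact (Complex.continuousWithinAt_log_of_re_neg_of_im_zero (z := (t : ℂ)) (by simpa using h)
        (by simp)).tendsto.comp hpath
    · exact (continuousAt_clog (x := (t : ℂ)) (Or.inl (by simpa using h))).tendsto.comp
        (hpath.mono_right nhdsWithin_le_nhds)
  have ht' : (t : ℂ) ≠ 0 := Complex.ofReal_ne_zero.2 ht
  rw [Complex.cpow_def_of_ne_zero ht']
  refine ((Complex.continuous_exp.tendsto _).comp (hlog.mul_const (p : ℂ))).congr fun ε => ?_
  have hne : (t : ℂ) + ε * Complex.I ≠ 0 := fun h0 => ht (by simpa using congrArg Complex.re h0)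
  rw [Complex.cpow_def_of_ne_zero hne]
  rfl

theorem tendsto_cpowPotential_add_mul_I {ν : Measure ℝ} {p x : ℝ} {g : ℝ → ℝ}
    (hx : ν {x} = 0) (hg : Integrable g ν)
    (hb : ∀ᶠ ε : ℝ in 𝓝[>] 0, ∀ᵐ y : ℝ ∂ν, ‖(x : ℂ) + ε * Complex.I - y‖ ^ p ≤ g y) :
    Tendsto (fun ε : ℝ => cpowPotential ν p (x + ε * Complex.I)) (𝓝[>] 0)
      (𝓝 (cpowPotential ν p x)) := by
  refine tendsto_integral_filter_of_dominated_convergence g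
    (Eventually.of_forall fun ε => (measurable_sub_cpow _ p).aestronglyMeasurable)
    (hb.mono fun ε hε => hε.mono fun y hy => by rwa [Complex.norm_cpow_real]) hg ?_
  have hne : ∀ᵐ y ∂ν, y ≠ x := measure_eq_zero_iff_ae_notMem.1 hx
  filter_upwards [hne] with y hy
  have := tendsto_add_mul_I_cpow (p := p) (sub_ne_zero.2 hy.symm)
  rw [Complex.ofReal_sub] at this
  refine this.congr fun ε => ?_
  congr 1
  ring

theorem norm_add_mul_I_sub_rpow_le {p x y : ℝ} (hp : p ≤ 0) (hxy : y ≠ x) (ε : ℝ) :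
    ‖(x : ℂ) + ε * Complex.I - y‖ ^ p ≤ ‖(x : ℂ) - y‖ ^ p := by
  refine Real.rpow_le_rpow_of_nonpos ?_ ?_ hp
  · rw [norm_pos_iff, ← Complex.ofReal_sub]
    exact Complex.ofReal_ne_zero.2 (sub_ne_zero.2 hxy.symm)
  · rw [← Complex.ofReal_sub, Complex.norm_real, Real.norm_eq_abs]
    simpa using Complex.abs_re_le_norm ((x : ℂ) + ε * Complex.I - y)

theorem tendsto_cpowPotential_of_nonpos {ν : Measure ℝ} {p x : ℝ} (hp : p ≤ 0)
    (hx : ν {x} = 0) (hint : Integrable (fun y : ℝ => ‖(x : ℂ) - y‖ ^ p) ν) :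
    Tendsto (fun ε : ℝ => cpowPotential ν p (x + ε * Complex.I)) (𝓝[>] 0)
      (𝓝 (cpowPotential ν p x)) :=
  tendsto_cpowPotential_add_mul_I hx hint (Eventually.of_forall fun ε =>
    (measure_eq_zero_iff_ae_notMem.1 hx).mono fun _ hy => norm_add_mul_I_sub_rpow_le hp hy ε)

theorem tendsto_cpowPotential_of_nonneg {ν : Measure ℝ} [IsFiniteMeasure ν] {R p x : ℝ}
    (hp : 0 ≤ p) (hR : ∀ᵐ y ∂ν, |y| ≤ R) (hx : ν {x} = 0) :
    Tendsto (fun ε : ℝ => cpowPotential ν p (x + ε * Complex.I)) (𝓝[>] 0)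
      (𝓝 (cpowPotential ν p x)) := by
  refine tendsto_cpowPotential_add_mul_I hx (integrable_const ((|x| + 1 + R) ^ p)) ?_
  filter_upwards [Ioo_mem_nhdsGT (zero_lt_one' ℝ)] with ε hε
  filter_upwards [hR] with y hy
  refine Real.rpow_le_rpow (norm_nonneg _) ((norm_sub_ofReal_le hy _).trans ?_) hp
  have : ‖(x : ℂ) + ε * Complex.I‖ ≤ |x| + ε := by
    refine (norm_add_le _ _).trans_eq ?_
    rw [norm_mul, Complex.norm_I, Complex.norm_real, Complex.norm_real, mul_one,
      Real.norm_eq_abs, Real.norm_of_nonneg hε.1.le]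
  linarith [hε.2]

/-! ### One-sided potentials and the density -/

theorem posPow_nonneg (t p : ℝ) : 0 ≤ posPow t p := by
  unfold posPow
  split_ifs with h
  · exact Real.rpow_nonneg h.le p
  · exact le_rfl

theorem posPow_of_nonpos {t : ℝ} (ht : t ≤ 0) (p : ℝ) : posPow t p = 0 :=
  if_neg (not_lt.2 ht)

theorem posPow_pos {t : ℝ} (ht : 0 < t) (p : ℝ) : 0 < posPow t p := by
  rw [posPow, if_pos ht]
  exact Real.rpow_pos_of_pos ht p

theorem measurable_posPow (p : ℝ) : Measurable fun t => posPow t p :=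
  Measurable.ite measurableSet_Ioi (by fun_prop) measurable_const

theorem posPow_le_abs_rpow (t p : ℝ) : posPow t p ≤ |t| ^ p := by
  unfold posPow
  split_ifs with h
  · rw [abs_of_pos h]
  · positivity

/-- On the real axis the principal branch of the power takes its boundary values from the upper half
plane. -/
theorem ofReal_cpow_eq_posPow {p : ℝ} (hp : p ≠ 0) (t : ℝ) :
    (t : ℂ) ^ (p : ℂ) =
      (posPow t p : ℂ) + Complex.exp (Real.pi * p * Complex.I) * (posPow (-t) p : ℂ) := by
  rcases lt_trichotomy t 0 with h | rfl | h
  · rw [posPow_of_nonpos h.le, posPow, if_pos (neg_pos.2 h), Complex.ofReal_cpow_of_nonpos h.le,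
      Complex.ofReal_cpow (neg_pos.2 h).le, Complex.ofReal_neg, Complex.ofReal_zero, zero_add,
      mul_comm]
    congr 2
    ring
  · simp [posPow, hp]
  · rw [posPow_of_nonpos (neg_nonpos.2 h.le), posPow, if_pos h, Complex.ofReal_cpow h.le]
    simp

theorem integrable_posPow {ν : Measure ℝ} {p : ℝ} {u : ℝ → ℝ} (hu : Measurable u)
    (hint : Integrable (fun y => |u y| ^ p) ν) : Integrable (fun y => posPow (u y) p) ν :=
  hint.mono' ((measurable_posPow p).comp hu).aestronglyMeasurable
    (Eventually.of_forall fun y => by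
      rw [Real.norm_of_nonneg (posPow_nonneg _ _)]
      exact posPow_le_abs_rpow _ _)

theorem norm_ofReal_sub_rpow (x y p : ℝ) : ‖(x : ℂ) - y‖ ^ p = |x - y| ^ p := by
  rw [← Complex.ofReal_sub, Complex.norm_real, Real.norm_eq_abs]

theorem integrable_posPow_sub {ν : Measure ℝ} {p x : ℝ}
    (hint : Integrable (fun y : ℝ => ‖(x : ℂ) - y‖ ^ p) ν) :
    Integrable (fun y => posPow (x - y) p) ν ∧ Integrable (fun y => posPow (-(x - y)) p) ν := by
  simp_rw [norm_ofReal_sub_rpow] at hint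
  exact ⟨integrable_posPow (by fun_prop) hint,
    integrable_posPow (by fun_prop) (by simpa only [abs_neg] using hint)⟩

theorem cpowPotential_ofReal {ν : Measure ℝ} {p x : ℝ} (hp : p ≠ 0)
    (hint : Integrable (fun y : ℝ => ‖(x : ℂ) - y‖ ^ p) ν) :
    cpowPotential ν p x = ((posPotential ν p x).toReal : ℂ) +
      Complex.exp (Real.pi * p * Complex.I) * ((negPotential ν p x).toReal : ℂ) := by
  obtain ⟨h1, h2⟩ := integrable_posPow_sub hint
  rw [posPotential, negPotential,
    ← integral_eq_lintegral_of_nonneg_ae (Eventually.of_forall fun y => posPow_nonneg _ _)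
      h1.aestronglyMeasurable,
    ← integral_eq_lintegral_of_nonneg_ae (Eventually.of_forall fun y => posPow_nonneg _ _)
      h2.aestronglyMeasurable,
    ← integral_complex_ofReal, ← integral_complex_ofReal, ← integral_const_mul,
    ← integral_add h1.ofReal (h2.ofReal.const_mul _)]
  refine integral_congr_ae (Eventually.of_forall fun y => ?_)
  simp only
  rw [← Complex.ofReal_sub, ofReal_cpow_eq_posPow hp]

theorem posPotential_ne_top {ν : Measure ℝ} {p x : ℝ}
    (hint : Integrable (fun y : ℝ => ‖(x : ℂ) - y‖ ^ p) ν) : posPotential ν p x ≠ ∞ :=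
  (integrable_posPow_sub hint).1.lintegral_lt_top.ne

theorem negPotential_ne_top {ν : Measure ℝ} {p x : ℝ}
    (hint : Integrable (fun y : ℝ => ‖(x : ℂ) - y‖ ^ p) ν) : negPotential ν p x ≠ ∞ :=
  (integrable_posPow_sub hint).2.lintegral_lt_top.ne

theorem normSq_add_exp_mul_I_mul (A B θ : ℝ) :
    Complex.normSq ((A : ℂ) + Complex.exp (θ * Complex.I) * B) =
      A ^ 2 + B ^ 2 + 2 * Real.cos θ * (A * B) := by
  rw [Complex.normSq_apply]
  simp only [Complex.add_re, Complex.add_im, Complex.re_mul_ofReal, Complex.im_mul_ofReal,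
    Complex.ofReal_re, Complex.ofReal_im, Complex.exp_ofReal_mul_I_re, Complex.exp_ofReal_mul_I_im]
  linear_combination B ^ 2 * Real.sin_sq_add_cos_sq θ

/-- With `A, B, P, Q` the one-sided potentials `A₊, A₋, P₊, P₋` and `θ = α π / 2`, this is `π` times the
density. -/
theorem im_neg_div_of_boundary_values (A B P Q θ : ℝ) :
    (-(((P : ℂ) - Complex.exp (θ * Complex.I) * Q) / (A + Complex.exp (θ * Complex.I) * B))).im =
      Real.sin θ * (A * Q + B * P) / (A ^ 2 + B ^ 2 + 2 * Real.cos θ * (A * B)) := by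
  rw [Complex.neg_im, Complex.div_im, normSq_add_exp_mul_I_mul, ← sub_div, ← neg_div]
  congr 1
  simp only [Complex.add_re, Complex.add_im, Complex.sub_re, Complex.sub_im, Complex.re_mul_ofReal,
    Complex.im_mul_ofReal, Complex.ofReal_re, Complex.ofReal_im, Complex.exp_ofReal_mul_I_re,
    Complex.exp_ofReal_mul_I_im]
  ring

/-- Where the potentials converge, the density is the boundary value of the imaginary part of the
transform, divided by `π`. -/
theorem ofReal_im_quadFormTransform {ν : Measure ℝ} {α x : ℝ} (hα0 : 0 < α)
    (hα2 : α < 2) (hA : Integrable (fun y : ℝ => ‖(x : ℂ) - y‖ ^ (α / 2)) ν)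
    (hP : Integrable (fun y : ℝ => ‖(x : ℂ) - y‖ ^ (α / 2 - 1)) ν)
    (hG : cpowPotential ν (α / 2) x ≠ 0) :
    0 ≤ (quadFormTransform ν α x).im ∧
    quadFormDensity ν α x = ENNReal.ofReal ((quadFormTransform ν α x).im / Real.pi) := by
  have hpi := Real.pi_pos
  have h1 := cpowPotential_ofReal (by linarith : α / 2 ≠ 0) hA
  have h2 := cpowPotential_ofReal (by linarith : α / 2 - 1 ≠ 0) hP
  -- lowering the exponent by one turns the phase by `-π`
  have hexp : Complex.exp (Real.pi * ((α / 2 - 1 : ℝ) : ℂ) * Complex.I) =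
      -Complex.exp (Real.pi * ((α / 2 : ℝ) : ℂ) * Complex.I) := by
    have : (Real.pi * ((α / 2 - 1 : ℝ) : ℂ) * Complex.I : ℂ) =
        Real.pi * ((α / 2 : ℝ) : ℂ) * Complex.I - Real.pi * Complex.I := by push_cast; ring
    rw [this, Complex.exp_sub, Complex.exp_pi_mul_I, div_neg, div_one]
  have hθ : (Real.pi * ((α / 2 : ℝ) : ℂ) : ℂ) = ((α * Real.pi / 2 : ℝ) : ℂ) := by
    push_cast; ring
  rw [hexp, hθ, neg_mul, ← sub_eq_add_neg] at h2
  rw [hθ] at h1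
  have hAt := posPotential_ne_top hA
  have hBt := negPotential_ne_top hA
  have hPt := posPotential_ne_top hP
  have hQt := negPotential_ne_top hP
  have him := im_neg_div_of_boundary_values (posPotential ν (α / 2) x).toReal
    (negPotential ν (α / 2) x).toReal (posPotential ν (α / 2 - 1) x).toReal
    (negPotential ν (α / 2 - 1) x).toReal (α * Real.pi / 2)
  have hsin : 0 ≤ Real.sin (α * Real.pi / 2) :=
    Real.sin_nonneg_of_nonneg_of_le_pi (by positivity) (by nlinarith)
  have hden : 0 < (posPotential ν (α / 2) x).toReal ^ 2 + (negPotential ν (α / 2) x).toReal ^ 2 +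
      2 * Real.cos (α * Real.pi / 2) *
        ((posPotential ν (α / 2) x).toReal * (negPotential ν (α / 2) x).toReal) := by
    have := Complex.normSq_pos.2 hG
    rwa [h1, normSq_add_exp_mul_I_mul] at this
  rw [← h1, ← h2, ← quadFormTransform_eq] at him
  rw [him]
  refine ⟨div_nonneg (mul_nonneg hsin (by positivity)) hden.le, ?_⟩
  have hnum : posPotential ν (α / 2) x * negPotential ν (α / 2 - 1) x +
      negPotential ν (α / 2) x * posPotential ν (α / 2 - 1) x =
      ENNReal.ofReal ((posPotential ν (α / 2) x).toReal * (negPotential ν (α / 2 - 1) x).toReal +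
        (negPotential ν (α / 2) x).toReal * (posPotential ν (α / 2 - 1) x).toReal) := by
    rw [ENNReal.ofReal_add (by positivity) (by positivity),
      ENNReal.ofReal_mul ENNReal.toReal_nonneg, ENNReal.ofReal_mul ENNReal.toReal_nonneg,
      ENNReal.ofReal_toReal hAt, ENNReal.ofReal_toReal hBt, ENNReal.ofReal_toReal hPt,
      ENNReal.ofReal_toReal hQt]
  rw [quadFormDensity, hnum, ← ENNReal.ofReal_div_of_pos hden, ← ENNReal.ofReal_mul (by positivity)]
  congr 1
  field_simp

theorem posPotential_pos {ν : Measure ℝ} (p : ℝ) {x : ℝ} (hx : 0 < ν (Set.Iio x)) :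
    0 < posPotential ν p x := by
  have hm : Measurable fun y => ENNReal.ofReal (posPow (x - y) p) :=
    ((measurable_posPow p).comp (by fun_prop)).ennreal_ofReal
  rw [posPotential, lintegral_pos_iff_support hm]
  refine hx.trans_le (measure_mono fun y (hy : y < x) => ?_)
  exact (ENNReal.ofReal_pos.2 (posPow_pos (sub_pos.2 hy) p)).ne'

theorem negPotential_pos {ν : Measure ℝ} (p : ℝ) {x : ℝ} (hx : 0 < ν (Set.Ioi x)) :
    0 < negPotential ν p x := by
  have hm : Measurable fun y => ENNReal.ofReal (posPow (-(x - y)) p) :=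
    ((measurable_posPow p).comp (by fun_prop)).ennreal_ofReal
  rw [negPotential, lintegral_pos_iff_support hm]
  refine hx.trans_le (measure_mono fun y (hy : x < y) => ?_)
  exact (ENNReal.ofReal_pos.2 (posPow_pos (by linarith) p)).ne'

theorem posPotential_eq_zero {ν : Measure ℝ} (p : ℝ) {x : ℝ} (hx : ∀ᵐ y ∂ν, x ≤ y) :
    posPotential ν p x = 0 := by
  refine (lintegral_congr_ae (hx.mono fun y hy => ?_)).trans lintegral_zero
  rw [posPow_of_nonpos (by linarith), ENNReal.ofReal_zero]

theorem negPotential_eq_zero {ν : Measure ℝ} (p : ℝ) {x : ℝ} (hx : ∀ᵐ y ∂ν, y ≤ x) :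
    negPotential ν p x = 0 := by
  refine (lintegral_congr_ae (hx.mono fun y hy => ?_)).trans lintegral_zero
  rw [posPow_of_nonpos (by linarith), ENNReal.ofReal_zero]

theorem quadFormDensity_eq_zero {ν : Measure ℝ} (hbdd : Bornology.IsBounded ν.support) (α : ℝ)
    {x : ℝ} (hx : x ∉ Set.Ioo (sInf ν.support) (sSup ν.support)) : quadFormDensity ν α x = 0 := by
  have hae := ae_mem_Icc_support hbdd
  rw [Set.mem_Ioo, not_and_or, not_lt, not_lt] at hx
  rcases hx with h | h
  · have h0 := fun p => posPotential_eq_zero (ν := ν) p (hae.mono fun y hy => h.trans hy.1)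
    simp [quadFormDensity, h0]
  · have h0 := fun p => negPotential_eq_zero (ν := ν) p (hae.mono fun y hy => hy.2.trans h)
    simp [quadFormDensity, h0]

theorem quadFormDensity_pos {ν : Measure ℝ} [IsProbabilityMeasure ν]
    (hbdd : Bornology.IsBounded ν.support) {α : ℝ} (hα0 : 0 < α) (hα2 : α < 2)
    {x : ℝ} (hx : x ∈ Set.Ioo (sInf ν.support) (sSup ν.support)) : 0 < quadFormDensity ν α x := by
  have hpi := Real.pi_pos
  have h1 : 0 < ν (Set.Iio x) :=
    (Measure.mem_support_iff_forall _).1 (sInf_support_mem hbdd) _ (Iio_mem_nhds hx.1)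
  have h2 : 0 < ν (Set.Ioi x) :=
    (Measure.mem_support_iff_forall _).1 (sSup_support_mem hbdd) _ (Ioi_mem_nhds hx.2)
  have hsin : 0 < Real.sin (α * Real.pi / 2) :=
    Real.sin_pos_of_pos_of_lt_pi (by positivity) (by nlinarith)
  refine ENNReal.mul_pos (ENNReal.ofReal_pos.2 (by positivity)).ne'
    (ENNReal.div_pos (ne_of_gt ?_) ENNReal.ofReal_ne_top).ne'
  exact (ENNReal.mul_pos (posPotential_pos _ h1).ne' (negPotential_pos _ h2).ne').trans_le
    le_self_add

theorem measurable_quadFormDensity (ν : Measure ℝ) [SFinite ν] (α : ℝ) :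
    Measurable (quadFormDensity ν α) := by
  have hpos : ∀ p, Measurable (posPotential ν p) := fun p =>
    Measurable.lintegral_prod_right' (f := fun q : ℝ × ℝ => ENNReal.ofReal (posPow (q.1 - q.2) p))
      ((measurable_posPow p).comp (by fun_prop)).ennreal_ofReal
  have hneg : ∀ p, Measurable (negPotential ν p) := fun p =>
    Measurable.lintegral_prod_right'
      (f := fun q : ℝ × ℝ => ENNReal.ofReal (posPow (-(q.1 - q.2)) p))
      ((measurable_posPow p).comp (by fun_prop)).ennreal_ofReal
  have h1 := hpos (α / 2)
  have h2 := hneg (α / 2)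
  have h3 := hpos (α / 2 - 1)
  have h4 := hneg (α / 2 - 1)
  unfold quadFormDensity
  fun_prop

/-! ### Local integrability of the potential on the real line -/

theorem ae_measure_singleton_eq_zero (ν : Measure ℝ) [SFinite ν] : ∀ᵐ x : ℝ, ν {x} = 0 := by
  have h : ∀ᵐ x : ℝ, ∀ᵐ y ∂ν, y ≠ x := by
    rw [Measure.ae_ae_comm (measurableSet_eq_fun measurable_snd measurable_fst).compl]
    exact Eventually.of_forall fun y =>
      (measure_eq_zero_iff_ae_notMem.1 (measure_singleton y)).mono fun x hx h => hx h.symm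
  exact h.mono fun x hx => measure_eq_zero_iff_ae_notMem.2 hx

theorem integrableOn_abs_rpow {p : ℝ} (hp : -1 < p) {L : ℝ} (hL : 0 ≤ L) :
    IntegrableOn (fun u : ℝ => |u| ^ p) (Set.Icc (-L) L) := by
  rw [← intervalIntegrable_iff_integrableOn_Icc_of_le (by linarith) (by simp)]
  refine intervalIntegrable_of_even (fun x => by rw [abs_neg]) (fun x hx => ?_) (by simp) (by simp)
  refine (intervalIntegral.intervalIntegrable_rpow' hp).congr_uIoo fun u hu => ?_
  rw [Set.uIoo_of_le hx.le] at hu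
  simp only
  rw [abs_of_pos hu.1]

/-- For exponents above `-1` the absolute power potential of a measure with bounded support is locally
integrable on the real line, by Fubini. -/
theorem integrableOn_absPotential {ν : Measure ℝ} [IsFiniteMeasure ν] {R p : ℝ}
    (hR : ∀ᵐ x ∂ν, |x| ≤ R) (hp : -1 < p) {T : ℝ} (hT : 0 ≤ T + R) :
    (∀ᵐ x : ℝ, |x| ≤ T → Integrable (fun y : ℝ => ‖(x : ℂ) - y‖ ^ p) ν) ∧
      IntegrableOn (fun x : ℝ => absPotential ν p x) (Set.Icc (-T) T) := by
  -- for `|x| ≤ T` the potential is the convolution of `ν` with a truncated, integrable power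
  set g : ℝ → ℝ := (Set.Icc (-(T + R)) (T + R)).indicator fun u => |u| ^ p with hg
  have hgint : Integrable g :=
    (integrable_indicator_iff measurableSet_Icc).2 (integrableOn_abs_rpow hp hT)
  have h0 := (integrable_const (1 : ℝ) (μ := ν)).convolution_integrand
    (ContinuousLinearMap.mul ℝ ℝ) hgint
  simp only [ContinuousLinearMap.mul_apply', one_mul] at h0
  have heq : ∀ x : ℝ, |x| ≤ T →
      (fun y => g (x - y)) =ᵐ[ν] fun y : ℝ => ‖(x : ℂ) - y‖ ^ p := by
    intro x hx
    filter_upwards [hR] with y hy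
    rw [norm_ofReal_sub_rpow, hg, Set.indicator_of_mem]
    rw [abs_le] at hx hy
    exact ⟨by linarith, by linarith⟩
  refine ⟨h0.prod_right_ae.mono fun x hx hxT => hx.congr (heq x hxT), ?_⟩
  refine (h0.integral_prod_left.integrableOn (s := Set.Icc (-T) T)).congr_fun (fun x hx => ?_)
    measurableSet_Icc
  exact integral_congr_ae (heq x (abs_le.2 hx))

theorem ae_integrable_norm_sub_rpow {ν : Measure ℝ} [IsFiniteMeasure ν] {R p : ℝ}
    (hR : ∀ᵐ x ∂ν, |x| ≤ R) (hR0 : 0 ≤ R) (hp : -1 < p) :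
    ∀ᵐ x : ℝ, Integrable (fun y : ℝ => ‖(x : ℂ) - y‖ ^ p) ν := by
  have h : ∀ᵐ x : ℝ, ∀ n : ℕ, |x| ≤ n → Integrable (fun y : ℝ => ‖(x : ℂ) - y‖ ^ p) ν :=
    ae_all_iff.2 fun n => (integrableOn_absPotential hR hp (by positivity)).1
  refine h.mono fun x hx => ?_
  obtain ⟨n, hn⟩ := exists_nat_ge |x|
  exact hx n hn

/-! ### Behaviour at infinity and conjugation -/

theorem one_add_norm_le_two_mul {R y : ℝ} (hy : |y| ≤ R) {z : ℂ} (hz : 2 * R + 1 ≤ ‖z‖) :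
    1 + ‖z‖ ≤ 2 * ‖z - (y : ℂ)‖ := by
  have h := norm_sub_norm_le z (y : ℂ)
  rw [Complex.norm_real, Real.norm_eq_abs] at h
  linarith

/-- Along the imaginary axis `-z s_μ(z)` tends to the total mass, because `z / (x - z) + 1 = x / (x - z)`. -/
theorem norm_mul_stieltjesTransform_add_le {μ : Measure ℝ} [IsFiniteMeasure μ] {R : ℝ}
    (hR : ∀ᵐ x ∂μ, |x| ≤ R) (hR0 : 0 ≤ R) {z : ℂ} (hz : 0 < z.im) :
    ‖z * stieltjesTransform μ z + μ.real Set.univ‖ ≤ R * μ.real Set.univ / z.im := by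
  have hint := integrable_one_div_ofReal_sub μ hz.ne'
  have heq : z * stieltjesTransform μ z + μ.real Set.univ =
      ∫ x : ℝ, (x : ℂ) * (1 / ((x : ℂ) - z)) ∂μ := by
    have h1 : (μ.real Set.univ : ℂ) = ∫ _ : ℝ, (1 : ℂ) ∂μ := by simp
    rw [stieltjesTransform_eq, h1, ← integral_const_mul,
      ← integral_add (hint.const_mul z) (integrable_const _)]
    refine integral_congr_ae (Eventually.of_forall fun x => ?_)
    have hne : (x : ℂ) - z ≠ 0 := fun h0 => by
      have := abs_im_le_norm_ofReal_sub z x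
      rw [h0, norm_zero, abs_of_pos hz] at this
      linarith
    simp only
    field_simp
    ring
  rw [heq]
  refine (norm_integral_le_of_norm_le_const (C := R / z.im) (hR.mono fun x hx => ?_)).trans_eq
    (by ring)
  have h2 := abs_im_le_norm_ofReal_sub z x
  rw [abs_of_pos hz] at h2
  rw [norm_mul, norm_div, norm_one, Complex.norm_real, Real.norm_eq_abs, mul_one_div]
  gcongr

theorem cpowPotential_conj {ν : Measure ℝ} (p : ℝ) {z : ℂ} (hz : z.im ≠ 0) :
    cpowPotential ν p (conj z) = conj (cpowPotential ν p z) := by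
  rw [cpowPotential, cpowPotential, ← integral_conj]
  refine integral_congr_ae (Eventually.of_forall fun x => ?_)
  simp only
  have harg : (z - (x : ℂ)).arg ≠ Real.pi := fun h =>
    hz (by simpa using (Complex.arg_eq_pi_iff.1 h).2)
  have := Complex.conj_cpow (z - (x : ℂ)) (p : ℂ) harg
  rw [Complex.conj_ofReal] at this
  rw [← this, map_sub, Complex.conj_ofReal]

theorem quadFormTransform_conj {ν : Measure ℝ} (α : ℝ) {z : ℂ} (hz : z.im ≠ 0) :
    quadFormTransform ν α (conj z) = conj (quadFormTransform ν α z) := by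
  simp only [quadFormTransform_eq, cpowPotential_conj _ hz, map_neg, map_div₀]

theorem stieltjesTransform_conj (μ : Measure ℝ) (z : ℂ) :
    stieltjesTransform μ (conj z) = conj (stieltjesTransform μ z) := by
  rw [stieltjesTransform_eq, stieltjesTransform_eq, ← integral_conj]
  simp

/-! ### Boundary values and size of the transform -/

theorem tendsto_quadFormTransform {ν : Measure ℝ} [IsFiniteMeasure ν] {R α x : ℝ}
    (hα0 : 0 < α) (hα2 : α < 2) (hR : ∀ᵐ y ∂ν, |y| ≤ R) (hx : ν {x} = 0)
    (hint : Integrable (fun y : ℝ => ‖(x : ℂ) - y‖ ^ (α / 2 - 1)) ν)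
    (hG : cpowPotential ν (α / 2) x ≠ 0) :
    Tendsto (fun ε : ℝ => quadFormTransform ν α (x + ε * Complex.I)) (𝓝[>] 0)
      (𝓝 (quadFormTransform ν α x)) := by
  simp_rw [quadFormTransform_eq]
  exact ((tendsto_cpowPotential_of_nonpos (by linarith) hx hint).div
    (tendsto_cpowPotential_of_nonneg (by linarith) hR hx) hG).neg

/-- Just above the real axis the transform is dominated, uniformly in the height, by a potential which
is locally integrable. -/
theorem norm_quadFormTransform_add_mul_I_le {ν : Measure ℝ} [IsFiniteMeasure ν] {R α c x : ℝ}
    (hα0 : 0 < α) (hα2 : α < 2) (hR : ∀ᵐ y ∂ν, |y| ≤ R) (hc0 : 0 < c)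
    (hc : ∀ z : ℂ, c ≤ absPotential ν (α / 2) z) (hx : ν {x} = 0)
    (hint : Integrable (fun y : ℝ => ‖(x : ℂ) - y‖ ^ (α / 2 - 1)) ν) {ε : ℝ} (hε : 0 ≤ ε) :
    ‖quadFormTransform ν α (x + ε * Complex.I)‖ ≤
      absPotential ν (α / 2 - 1) x / (Real.cos (Real.pi * (α / 2) / 2) * c) := by
  have hcos := cos_pi_mul_div_two_pos (a := α / 2) (by linarith) (by linarith)
  have hG := cos_mul_absPotential_le_norm (a := α / 2) (by linarith) (by linarith) hR
    (z := x + ε * Complex.I) (by simpa using hε)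
  have hG' := (mul_le_mul_of_nonneg_left (hc (x + ε * Complex.I)) hcos.le).trans hG
  rw [quadFormTransform_eq, norm_neg, norm_div]
  refine div_le_div₀ (absPotential_nonneg _ _ _) ((norm_cpowPotential_le _ _ _).trans ?_)
    (by positivity) hG'
  exact integral_mono_of_nonneg (Eventually.of_forall fun _ => by positivity) hint
    ((measure_eq_zero_iff_ae_notMem.1 hx).mono fun y hy =>
      norm_add_mul_I_sub_rpow_le (by linarith) hy ε)

theorem norm_quadFormTransform_le {ν : Measure ℝ} [IsFiniteMeasure ν] {R α K : ℝ}
    (hα0 : 0 < α) (hα2 : α < 2) (hR : ∀ᵐ y ∂ν, |y| ≤ R) {z : ℂ} (hz : 0 ≤ z.im)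
    (hpos : 0 < absPotential ν (α / 2) z) (hK : ∀ᵐ x : ℝ ∂ν, 1 + ‖z‖ ≤ K * ‖z - (x : ℂ)‖) :
    ‖quadFormTransform ν α z‖ ≤ K / Real.cos (Real.pi * (α / 2) / 2) / (1 + ‖z‖) := by
  rw [quadFormTransform_eq, norm_neg]
  exact norm_cpowPotential_div_le (by linarith) (by linarith) hR hz hpos hK

theorem differentiableAt_quadFormTransform {ν : Measure ℝ} [IsFiniteMeasure ν] {R α : ℝ}
    (hα0 : 0 < α) (hα2 : α < 2) (hR : ∀ᵐ y ∂ν, |y| ≤ R) {z : ℂ} (hz : 0 < z.im)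
    (hpos : 0 < absPotential ν (α / 2) z) : DifferentiableAt ℂ (quadFormTransform ν α) z := by
  have hG := cos_mul_absPotential_le_norm (a := α / 2) (by linarith) (by linarith) hR hz.le
  have hcos := cos_pi_mul_div_two_pos (a := α / 2) (by linarith) (by linarith)
  have hfun : quadFormTransform ν α = fun z =>
      -(cpowPotential ν (α / 2 - 1) z / cpowPotential ν (α / 2) z) :=
    funext fun z => quadFormTransform_eq ν α z
  rw [hfun]
  exact ((differentiableAt_cpowPotential hR hz).div (differentiableAt_cpowPotential hR hz)
    (norm_pos_iff.1 ((mul_pos hcos hpos).trans_le hG))).neg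

/-- The Cauchy integral formula for the transform on the horizontal line at height `ε`. -/
theorem quadFormTransform_eq_integral_of_pos {ν : Measure ℝ} [IsFiniteMeasure ν] {R α ε : ℝ}
    (hα0 : 0 < α) (hα2 : α < 2) (hR : ∀ᵐ y ∂ν, |y| ≤ R) (hR0 : 0 ≤ R)
    (hpos : ∀ z : ℂ, 0 < absPotential ν (α / 2) z) (hε : 0 < ε) {z : ℂ} (hz : 0 < z.im) :
    quadFormTransform ν α (z + ε * Complex.I) = (1 / Real.pi : ℂ) *
      ∫ x : ℝ, ((quadFormTransform ν α (x + ε * Complex.I)).im : ℂ) / (x - z) := by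
  set K : ℝ := (1 + R) / ε + 1 with hKdef
  refine eq_integral_im_div_sub (F := fun w => quadFormTransform ν α (w + ε * Complex.I))
    (C := K / Real.cos (Real.pi * (α / 2) / 2)) (fun w hw => ?_) (fun w hw => ?_) hz
  · have h1 : 0 < (w + ε * Complex.I).im := by
      have : 0 ≤ w.im := hw
      simp
      linarith
    have h2 := differentiableAt_quadFormTransform hα0 hα2 hR h1 (hpos _)
    exact (h2.comp w (by fun_prop : DifferentiableAt ℂ (fun w => w + ε * Complex.I) w)
      ).differentiableWithinAt
  · have h1 : 0 ≤ (w + ε * Complex.I).im := by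
      simp
      linarith
    have hcos := cos_pi_mul_div_two_pos (a := α / 2) (by linarith) (by linarith)
    have hnorm : ‖w‖ ≤ ‖w + ε * Complex.I‖ := by
      rw [Complex.norm_def, Complex.norm_def]
      refine Real.sqrt_le_sqrt ?_
      simp only [Complex.normSq_apply, Complex.add_re, Complex.add_im, Complex.re_ofReal_mul,
        Complex.im_ofReal_mul, Complex.I_re, Complex.I_im, mul_zero, mul_one, add_zero]
      nlinarith
    have hK : ∀ᵐ x : ℝ ∂ν, 1 + ‖w + ε * Complex.I‖ ≤ K * ‖w + ε * Complex.I - (x : ℂ)‖ := by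
      filter_upwards [hR] with x hx
      refine one_add_norm_le_mul_norm_sub hε (by simpa using hx) ((le_trans ?_ (le_abs_self _)).trans
        (Complex.abs_im_le_norm _))
      simpa using hw
    have hK0 : 0 ≤ K := by positivity
    refine (norm_quadFormTransform_le hα0 hα2 hR h1 (hpos _) hK).trans ?_
    gcongr

/-! ### The measure with the explicit density -/

/-- The limit `ε → 0` of the Cauchy integral formula on horizontal lines. The integrand uses the values of
the transform on the real axis itself, which are its limits from above almost everywhere. -/
theorem quadFormTransform_eq_integral {ν : Measure ℝ} [IsFiniteMeasure ν] {R α c : ℝ}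
    (hα0 : 0 < α) (hα2 : α < 2) (hR : ∀ᵐ y ∂ν, |y| ≤ R) (hR0 : 0 ≤ R) (hc0 : 0 < c)
    (hc : ∀ z : ℂ, c ≤ absPotential ν (α / 2) z) {z : ℂ} (hz : 0 < z.im) :
    quadFormTransform ν α z = (1 / Real.pi : ℂ) *
      ∫ x : ℝ, ((quadFormTransform ν α x).im : ℂ) / (x - z) := by
  have hpos : ∀ z : ℂ, 0 < absPotential ν (α / 2) z := fun z => hc0.trans_le (hc z)
  have hcos := cos_pi_mul_div_two_pos (a := α / 2) (by linarith) (by linarith)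
  set κ := Real.cos (Real.pi * (α / 2) / 2) with hκ
  have hleft : Tendsto (fun ε : ℝ => quadFormTransform ν α (z + ε * Complex.I)) (𝓝[>] 0)
      (𝓝 (quadFormTransform ν α z)) := by
    have h1 := (differentiableAt_quadFormTransform hα0 hα2 hR hz (hpos z)).continuousAt
    have h2 : Tendsto (fun ε : ℝ => z + ε * Complex.I) (𝓝 0) (𝓝 (z + (0 : ℝ) * Complex.I)) :=
      Continuous.tendsto (by fun_prop) 0
    rw [Complex.ofReal_zero, zero_mul, add_zero] at h2
    exact h1.tendsto.comp (h2.mono_left nhdsWithin_le_nhds)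
  refine tendsto_nhds_unique hleft ?_
  refine Tendsto.congr' (eventually_mem_nhdsWithin.mono fun ε (hε : 0 < ε) =>
    (quadFormTransform_eq_integral_of_pos hα0 hα2 hR hR0 hpos hε hz).symm) ?_
  refine Tendsto.const_mul _ ?_
  set T := 2 * R + 1 with hT
  have hT0 : 0 ≤ T + R := by positivity
  set K : ℝ := (1 + ‖z‖) / z.im + 1 with hK
  have hK0 : 0 < K := by positivity
  have hne : ∀ x : ℝ, 0 < ‖(x : ℂ) - z‖ ∧ 1 / ‖(x : ℂ) - z‖ ≤ K / (1 + |x|) := fun x => by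
    have h1 := abs_im_le_norm_ofReal_sub z x
    rw [abs_of_pos hz] at h1
    have h2 := one_add_norm_le_mul_norm_sub (w := (x : ℂ)) hz le_rfl h1
    rw [Complex.norm_real, Real.norm_eq_abs] at h2
    refine ⟨hz.trans_le h1, ?_⟩
    rw [div_le_div_iff₀ (hz.trans_le h1) (by positivity)]
    linarith
  -- the majorant: the potential itself near the support, an inverse square far away
  set B : ℝ → ℝ := fun x => (Set.Icc (-T) T).indicator
    (fun x : ℝ => absPotential ν (α / 2 - 1) x / (κ * c) * K) x + 2 / κ * K * (1 + x ^ 2)⁻¹ with hB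
  have hBint : Integrable B :=
    ((integrable_indicator_iff measurableSet_Icc).2
      (((integrableOn_absPotential hR (by linarith : -1 < α / 2 - 1) hT0).2.div_const _).mul_const
        K)).add (integrable_inv_one_add_sq.const_mul _)
  have hae1 := ae_measure_singleton_eq_zero ν
  have hae2 := ae_integrable_norm_sub_rpow hR hR0 (by linarith : -1 < α / 2 - 1)
  refine tendsto_integral_filter_of_dominated_convergence B ?_ ?_ hBint ?_
  · filter_upwards [eventually_mem_nhdsWithin] with ε hε
    have hcont : Continuous fun x : ℝ => quadFormTransform ν α (x + ε * Complex.I) := by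
      refine continuous_iff_continuousAt.2 fun x => ?_
      have h1 : 0 < ((x : ℂ) + ε * Complex.I).im := by simpa using hε
      exact (differentiableAt_quadFormTransform hα0 hα2 hR h1 (hpos _)).continuousAt.comp
        (f := fun x : ℝ => (x : ℂ) + ε * Complex.I) (by fun_prop)
    exact ((Complex.measurable_ofReal.comp (Complex.measurable_im.comp hcont.measurable)).div
      (by fun_prop)).aestronglyMeasurable
  · filter_upwards [eventually_mem_nhdsWithin] with ε hε
    have hε0 : 0 ≤ ε := le_of_lt hε
    filter_upwards [hae1, hae2] with x hx1 hx2
    obtain ⟨h1, h2⟩ := hne x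
    have him : ‖((quadFormTransform ν α (x + ε * Complex.I)).im : ℂ) / (x - z)‖ ≤
        ‖quadFormTransform ν α (x + ε * Complex.I)‖ * (K / (1 + |x|)) := by
      rw [norm_div, div_eq_mul_one_div, Complex.norm_real]
      gcongr
      exact Complex.abs_im_le_norm _
    refine him.trans ?_
    by_cases hxT : x ∈ Set.Icc (-T) T
    · simp only [hB, Set.indicator_of_mem hxT]
      refine le_trans ?_ (le_add_of_nonneg_right (by positivity))
      have h3 := norm_quadFormTransform_add_mul_I_le hα0 hα2 hR hc0 hc hx1 hx2 hε0
      have h4 : K / (1 + |x|) ≤ K := div_le_self hK0.le (by linarith [abs_nonneg x])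
      exact mul_le_mul h3 h4 (by positivity) ((norm_nonneg _).trans h3)
    · simp only [hB, Set.indicator_of_notMem hxT, zero_add]
      have hxT' : T ≤ |x| := by
        rw [Set.mem_Icc, ← abs_le] at hxT
        exact (not_le.1 hxT).le
      have hxn : |x| ≤ ‖(x : ℂ) + ε * Complex.I‖ := by
        simpa using Complex.abs_re_le_norm ((x : ℂ) + ε * Complex.I)
      have h3 := norm_quadFormTransform_le hα0 hα2 hR (z := x + ε * Complex.I) (by simpa using hε0)
        (hpos _) (hR.mono fun y hy => one_add_norm_le_two_mul hy (hxT'.trans hxn))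
      have h4 : ‖quadFormTransform ν α (x + ε * Complex.I)‖ ≤ 2 / κ / (1 + |x|) :=
        h3.trans (by gcongr)
      calc _ ≤ 2 / κ / (1 + |x|) * (K / (1 + |x|)) := by gcongr
        _ = 2 / κ * K * ((1 + |x|) ^ 2)⁻¹ := by field_simp
        _ ≤ _ := by
          gcongr
          nlinarith [abs_nonneg x, sq_abs x]
  · filter_upwards [hae1, hae2] with x hx1 hx2
    have hG := cos_mul_absPotential_le_norm (a := α / 2) (by linarith) (by linarith) hR
      (z := (x : ℂ)) (by simp)
    have h1 := tendsto_quadFormTransform hα0 hα2 hR hx1 hx2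
      (norm_pos_iff.1 ((mul_pos hcos (hpos _)).trans_le hG))
    exact ((Complex.continuous_ofReal.tendsto _).comp
      ((Complex.continuous_im.tendsto _).comp h1)).div_const _

theorem ae_quadFormDensity_eq {ν : Measure ℝ} [IsFiniteMeasure ν] {R α c : ℝ}
    (hα0 : 0 < α) (hα2 : α < 2) (hR : ∀ᵐ y ∂ν, |y| ≤ R) (hR0 : 0 ≤ R) (hc0 : 0 < c)
    (hc : ∀ z : ℂ, c ≤ absPotential ν (α / 2) z) :
    ∀ᵐ x : ℝ, 0 ≤ (quadFormTransform ν α x).im ∧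
      quadFormDensity ν α x = ENNReal.ofReal ((quadFormTransform ν α x).im / Real.pi) := by
  have hcos := cos_pi_mul_div_two_pos (a := α / 2) (by linarith) (by linarith)
  filter_upwards [ae_integrable_norm_sub_rpow hR hR0 (by linarith : -1 < α / 2 - 1)] with x hx
  have hG := cos_mul_absPotential_le_norm (a := α / 2) (by linarith) (by linarith) hR
    (z := (x : ℂ)) (by simp)
  exact ofReal_im_quadFormTransform hα0 hα2 (integrable_norm_sub_rpow (by linarith) hR _) hx
    (norm_pos_iff.1 ((mul_pos hcos (hc0.trans_le (hc _))).trans_le hG))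

theorem lintegral_quadFormDensity_lt_top {ν : Measure ℝ} [IsFiniteMeasure ν] {R α c : ℝ}
    (hα0 : 0 < α) (hα2 : α < 2) (hR : ∀ᵐ y ∂ν, |y| ≤ R) (hR0 : 0 ≤ R) (hc0 : 0 < c)
    (hc : ∀ z : ℂ, c ≤ absPotential ν (α / 2) z)
    (hzero : ∀ x, x ∉ Set.Icc (-R) R → quadFormDensity ν α x = 0) :
    ∫⁻ x, quadFormDensity ν α x < ∞ := by
  have hint := (integrableOn_absPotential hR (by linarith : -1 < α / 2 - 1)
    (by positivity : 0 ≤ R + R)).2.div_const (Real.cos (Real.pi * (α / 2) / 2) * c)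
  rw [← setLIntegral_eq_of_support_subset (s := Set.Icc (-R) R) (fun x hx => by
    by_contra h
    exact hx (hzero x h))]
  refine lt_of_le_of_lt (lintegral_mono_ae ?_) hint.lintegral_lt_top
  refine ae_restrict_of_ae ?_
  filter_upwards [ae_quadFormDensity_eq hα0 hα2 hR hR0 hc0 hc, ae_measure_singleton_eq_zero ν,
    ae_integrable_norm_sub_rpow hR hR0 (by linarith : -1 < α / 2 - 1)] with x hx hx1 hx2
  rw [hx.2]
  refine ENNReal.ofReal_le_ofReal ?_
  have h3 := norm_quadFormTransform_add_mul_I_le hα0 hα2 hR hc0 hc hx1 hx2 le_rfl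
  rw [Complex.ofReal_zero, zero_mul, add_zero] at h3
  refine (div_le_self hx.1 ?_).trans
    (((le_abs_self _).trans (Complex.abs_im_le_norm _)).trans h3)
  linarith [Real.pi_gt_three]

theorem stieltjesTransform_withDensity_quadFormDensity {ν : Measure ℝ} [IsFiniteMeasure ν]
    {R α c : ℝ} (hα0 : 0 < α) (hα2 : α < 2) (hR : ∀ᵐ y ∂ν, |y| ≤ R) (hR0 : 0 ≤ R) (hc0 : 0 < c)
    (hc : ∀ z : ℂ, c ≤ absPotential ν (α / 2) z) {z : ℂ} (hz : 0 < z.im) :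
    stieltjesTransform (volume.withDensity (quadFormDensity ν α)) z = quadFormTransform ν α z := by
  have hae := ae_quadFormDensity_eq hα0 hα2 hR hR0 hc0 hc
  rw [quadFormTransform_eq_integral hα0 hα2 hR hR0 hc0 hc hz, stieltjesTransform_eq,
    integral_withDensity_eq_integral_toReal_smul (measurable_quadFormDensity ν α)
      (hae.mono fun x hx => hx.2 ▸ ENNReal.ofReal_lt_top), ← integral_const_mul]
  refine integral_congr_ae (hae.mono fun x hx => ?_)
  simp only
  rw [hx.2, ENNReal.toReal_ofReal (div_nonneg hx.1 Real.pi_pos.le), Complex.real_smul]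
  push_cast
  ring

/-- The mass is read off from the first-order asymptotics of both sides at `i y`, as `y → ∞`. -/
theorem measureReal_univ_eq_one_of_stieltjesTransform_eq {ν μ : Measure ℝ} [IsFiniteMeasure ν]
    [IsFiniteMeasure μ] {R α c : ℝ} (hα0 : 0 < α) (hα2 : α < 2) (hR : ∀ᵐ y ∂ν, |y| ≤ R)
    (hR0 : 0 ≤ R) (hc0 : 0 < c) (hc : ∀ z : ℂ, c ≤ absPotential ν (α / 2) z)
    (hRμ : ∀ᵐ y ∂μ, |y| ≤ R)
    (h : ∀ z : ℂ, 0 < z.im → stieltjesTransform μ z = quadFormTransform ν α z) :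
    μ.real Set.univ = 1 := by
  have hcos := cos_pi_mul_div_two_pos (a := α / 2) (by linarith) (by linarith)
  set κ := Real.cos (Real.pi * (α / 2) / 2)
  set m := μ.real Set.univ
  have hlim : Tendsto (fun y : ℝ => (R * m + R * (2 / κ)) / y) atTop (𝓝 0) :=
    tendsto_const_nhds.div_atTop tendsto_id
  have hle : |m - 1| ≤ 0 := by
    refine ge_of_tendsto hlim ?_
    filter_upwards [eventually_ge_atTop (2 * R + 1)] with y hy
    have hy0 : 0 < y := by linarith
    have him : ((y : ℂ) * Complex.I).im = y := by simp
    have hnorm : ‖(y : ℂ) * Complex.I‖ = y := by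
      rw [norm_mul, Complex.norm_I, mul_one, Complex.norm_real, Real.norm_of_nonneg hy0.le]
    have h1 := norm_mul_stieltjesTransform_add_le hRμ hR0 (z := y * Complex.I) (by rwa [him])
    have h2 := norm_mul_cpowPotential_div_sub_one_le (a := α / 2) (K := 2) (by linarith)
      (by linarith) hR hR0 (z := y * Complex.I) (by rw [him]; exact hy0.le) (hc0.trans_le (hc _))
      (hR.mono fun x hx => one_add_norm_le_two_mul hx (by rwa [hnorm])) (by norm_num)
    rw [h _ (by rwa [him]), quadFormTransform_eq, him] at h1
    rw [hnorm] at h2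
    set q := cpowPotential ν (α / 2 - 1) (y * Complex.I) / cpowPotential ν (α / 2) (y * Complex.I)
    have h3 : ((m - 1 : ℝ) : ℂ) =
        (y * Complex.I * -q + m) + (y * Complex.I * q - 1) := by push_cast; ring
    have h4 : |m - 1| = ‖((m - 1 : ℝ) : ℂ)‖ := by rw [Complex.norm_real, Real.norm_eq_abs]
    rw [h4, h3]
    refine (norm_add_le _ _).trans ((add_le_add h1 h2).trans ?_)
    rw [add_div, mul_div_assoc R (2 / κ) y]
    gcongr
    linarith
  linarith [abs_eq_zero.1 (le_antisymm hle (abs_nonneg _))]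

/-- Equality on the upper half plane propagates to the complement of an interval carrying both measures:
by conjugation below the real axis, and by continuity from above on it. -/
theorem stieltjesTransform_eq_of_notMem_Icc {ν μ : Measure ℝ} [IsFiniteMeasure ν]
    [IsFiniteMeasure μ] {R α c l u : ℝ} (hα0 : 0 < α) (hα2 : α < 2) (hR : ∀ᵐ y ∂ν, |y| ≤ R)
    (hc0 : 0 < c) (hc : ∀ z : ℂ, c ≤ absPotential ν (α / 2) z)
    (hν : ∀ᵐ y ∂ν, y ∈ Set.Icc l u) (hμ : ∀ᵐ y ∂μ, y ∈ Set.Icc l u)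
    (h : ∀ z : ℂ, 0 < z.im → stieltjesTransform μ z = quadFormTransform ν α z)
    {z : ℂ} (hz : ∀ t ∈ Set.Icc l u, z ≠ (t : ℂ)) :
    stieltjesTransform μ z = quadFormTransform ν α z := by
  rcases lt_trichotomy z.im 0 with him | him | him
  · have h1 := h (conj z) (by simpa using him)
    rw [stieltjesTransform_conj, quadFormTransform_conj α him.ne] at h1
    exact (starRingEnd ℂ).injective h1
  · obtain ⟨x, rfl⟩ : ∃ x : ℝ, z = x := ⟨z.re, Complex.ext rfl (by simpa using him)⟩
    have hx : x ∉ Set.Icc l u := fun hx => hz x hx rfl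
    obtain ⟨δ, hδ0, hδ⟩ := Metric.isOpen_iff.1 (isClosed_Icc (a := l) (b := u)).isOpen_compl x hx
    have hdist : ∀ y ∈ Set.Icc l u, δ ≤ ‖(x : ℂ) - (y : ℝ)‖ := fun y hy => by
      rw [← Complex.ofReal_sub, Complex.norm_real, ← dist_eq_norm, dist_comm]
      exact not_lt.1 fun hlt => hδ (Metric.mem_ball.2 hlt) hy
    have hν0 : ν {x} = 0 :=
      measure_eq_zero_iff_ae_notMem.2 (hν.mono fun y hy (h : y = x) => hx (h ▸ hy))
    have hcos := cos_pi_mul_div_two_pos (a := α / 2) (by linarith) (by linarith)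
    have hG := cos_mul_absPotential_le_norm (a := α / 2) (by linarith) (by linarith) hR
      (z := (x : ℂ)) (by simp)
    have hright := tendsto_quadFormTransform hα0 hα2 hR hν0
      (integrable_norm_sub_rpow_of_le hR hδ0 (hν.mono hdist))
      (norm_pos_iff.1 ((mul_pos hcos (hc0.trans_le (hc _))).trans_le hG))
    have hsupp : μ.support ⊆ Set.Icc l u := Measure.support_subset_of_isClosed isClosed_Icc hμ
    have hcont := (hasDerivAt_resolventTransform (μ := μ) (x : ℂ) (by
      rintro ⟨y, hy, hyx⟩
      exact hz y (hsupp hy) (by simpa using hyx.symm))).continuousAt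
    have hpath : Tendsto (fun ε : ℝ => (x : ℂ) + ε * Complex.I) (𝓝 0)
        (𝓝 ((x : ℂ) + (0 : ℝ) * Complex.I)) := Continuous.tendsto (by fun_prop) 0
    rw [Complex.ofReal_zero, zero_mul, add_zero] at hpath
    have hleft : Tendsto (fun ε : ℝ => stieltjesTransform μ (x + ε * Complex.I)) (𝓝[>] 0)
        (𝓝 (stieltjesTransform μ x)) :=
      hcont.tendsto.comp (hpath.mono_left nhdsWithin_le_nhds)
    refine tendsto_nhds_unique hleft
      (hright.congr' (eventually_mem_nhdsWithin.mono fun ε (hε : 0 < ε) => ?_))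
    exact (h _ (by simpa using hε)).symm
  · exact h z him

theorem mainTheorem2 (ν : Measure ℝ) [IsProbabilityMeasure ν] (α : ℝ)
    (hα0 : 0 < α) (hα2 : α < 2)
    (hbdd : Bornology.IsBounded ν.support)
    (hnondeg : ∀ b : ℝ, ν ≠ Measure.dirac b) :
    ∃ μ : Measure ℝ, IsProbabilityMeasure μ ∧
      -- the Stieltjes transform of `μ`, off the convex hull of the support of `ν`
      (∀ z : ℂ, (∀ t ∈ Set.Icc (sInf ν.support) (sSup ν.support), z ≠ (t : ℂ)) →
        stieltjesTransform μ z = quadFormTransform ν α z) ∧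
      -- `μ` is the only probability measure with this transform on the upper half plane
      (∀ μ' : Measure ℝ, IsProbabilityMeasure μ' →
        (∀ z : ℂ, 0 < z.im → stieltjesTransform μ' z = quadFormTransform ν α z) → μ' = μ) ∧
      (∀ a : ℝ, μ {a} = 0) ∧
      μ ≪ volume ∧
      μ = volume.withDensity (quadFormDensity ν α) ∧
      (∀ᵐ x : ℝ, quadFormDensity ν α x < ∞) ∧
      (∀ x ∈ Set.Ioo (sInf ν.support) (sSup ν.support), 0 < quadFormDensity ν α x) ∧
      (∀ x : ℝ, x ∉ Set.Ioo (sInf ν.support) (sSup ν.support) → quadFormDensity ν α x = 0) := by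
  set m := sInf ν.support
  set M := sSup ν.support
  set R := max |m| |M|
  have hR0 : 0 ≤ R := (abs_nonneg m).trans (le_max_left _ _)
  have hsub : ∀ x ∈ Set.Icc m M, |x| ≤ R := fun x hx => abs_le_max_abs_abs hx.1 hx.2
  have hνK : ∀ᵐ x ∂ν, x ∈ Set.Icc m M := ae_mem_Icc_support hbdd
  have hR : ∀ᵐ x ∂ν, |x| ≤ R := hνK.mono hsub
  obtain ⟨c, hc0, hc⟩ :=
    exists_pos_le_absPotential hbdd hnondeg (by linarith : 0 < α / 2) hR
  have hzero : ∀ x, x ∉ Set.Icc m M → quadFormDensity ν α x = 0 := fun x hx =>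
    quadFormDensity_eq_zero hbdd α fun h => hx (Set.Ioo_subset_Icc_self h)
  have hfin := lintegral_quadFormDensity_lt_top hα0 hα2 hR hR0 hc0 hc fun x hx =>
    hzero x fun h => hx (abs_le.1 (hsub x h))
  have hmeas := measurable_quadFormDensity ν α
  set μ := volume.withDensity (quadFormDensity ν α) with hμdef
  have : IsFiniteMeasure μ := isFiniteMeasure_withDensity hfin.ne
  have hμK : ∀ᵐ x ∂μ, x ∈ Set.Icc m M := by
    rw [hμdef, ae_withDensity_iff hmeas]
    refine Eventually.of_forall fun x hx => ?_
    by_contra h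
    exact hx (hzero x h)
  have hS : ∀ z : ℂ, 0 < z.im → stieltjesTransform μ z = quadFormTransform ν α z := fun z hz =>
    stieltjesTransform_withDensity_quadFormDensity hα0 hα2 hR hR0 hc0 hc hz
  have hmass : μ.real Set.univ = 1 :=
    measureReal_univ_eq_one_of_stieltjesTransform_eq hα0 hα2 hR hR0 hc0 hc (hμK.mono hsub) hS
  have hprob : IsProbabilityMeasure μ := ⟨by
    rw [← ENNReal.ofReal_toReal (measure_ne_top μ Set.univ)]
    change ENNReal.ofReal (μ.real Set.univ) = 1
    rw [hmass, ENNReal.ofReal_one]⟩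
  have hac : μ ≪ volume := withDensity_absolutelyContinuous _ _
  refine ⟨μ, hprob, fun z hz =>
    stieltjesTransform_eq_of_notMem_Icc hα0 hα2 hR hc0 hc hνK hμK hS hz, fun μ' hμ' h' => ?_,
    fun a => hac (measure_singleton a), hac, hμdef, ?_,
    fun x hx => quadFormDensity_pos hbdd hα0 hα2 hx,
    fun x hx => quadFormDensity_eq_zero hbdd α hx⟩
  · exact eq_of_stieltjesTransform_eq fun z hz => (h' z hz).trans (hS z hz).symm
  · exact (ae_quadFormDensity_eq hα0 hα2 hR hR0 hc0 hc).mono fun x hx =>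
      hx.2 ▸ ENNReal.ofReal_lt_top
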